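/- Let $Q$ be an $n$-dimensional simple convex polytope with vertex set $V(Q)$, $\ell=|V(Q)|$, and facets $F_1,\dots,F_m$. *Retraction sequences.* A polytopal complex $B$ (a union of faces of $Q$) has $v\in B\cap V(Q)$ as a *free vertex* if $v$ has a neighbourhood in $B$ homeomorphic to $\mathbb R^d_{\ge 0}$ as a manifold with corners, where $d\ge 1$ (or $d=0$ if $B=\{v\}$); let $E$ be the unique $d$-dimensional face of $B$ containing $v$. A *retraction sequence* is a sequence of triples $(B_k,E_k,b_k)$, $1\le k\le \ell$, where $B_1=Q$, $B_k$ is the union of the faces of $B_{k-1}$ that do not contain $b_{k-1}$, $b_k$ is a free vertex of $B_k$ with corresponding face $E_k$, and $B_\ell=E_\ell=\{b_\ell\}$. $Q$ is *admissible* if every non-empty complex obtained from $Q$ by successively removing free vertices in this way has a free vertex. *Toric orbifolds.* Let $\lambda:\{F_1,\dots,F_m\}\to\mathbb Z^n$ be such that $\lambda(F_{i_1}),\dots,\lambda(F_{i_k})$ are linearly independent whenever $F_{i_1}\cap\dots\cap F_{i_k}\ne\varnothing$. Put $X(Q,\lambda)=Q\times T^n/\!\sim$, where $(x,t)\sim(y,s)$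 iff $x=y$ and $t^{-1}s\in T_{E(x)}$, the subtorus generated by the $\lambda(F_i)$ with $x\in F_i$, and let $\pi:X(Q,\lambda)\to Q$ be the orbit map. For a face $E$ let $\rho_E$ be the projection of $\mathbb Z^n$ onto $N_E=\mathbb Z^n/\big((\mathrm{span}_{\mathbb Z}\{\lambda(F_i): E\subseteq F_i\}\otimes\mathbb R)\cap\mathbb Z^n\big)\cong\mathbb Z^{\dim E}$. For a vertex $v\in E$ let $g_E(v)=|\det[\lambda_E(E\cap F_j)]_j|$, where $F_j$ runs over the facets containing $v$ but not $E$, and $\lambda_E(E\cap F_j)$ is the primitive vector in the direction of $\rho_E(\lambda(F_j))$ if $E\neq Q$, and $\lambda_Q(F_j)=\lambda(F_j)$. If $v$ is a free vertex of $B$ with corresponding face $E$, put $g_B(v)=g_E(v)$. *Building sequences.* A *building sequence* $\{(Y_i,0_i)\}_{i=1}^{\ell}$ of a space $X$ is a chain of subspaces $\varnothing=Y_0\subset Y_1\subset\dots\subset Y_\ell=X$ in which $Y_i$ is obtained from $Y_{i-1}$ by attaching one $\mathbf q$-cell $e^{k_i}/G_i$ (that is, by gluing $\overline D^{k_i}/G_i$,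 with $G_i$ a finite group acting linearly on the disc, along a continuous map $S^{k_i-1}/G_i\to Y_{i-1}$; the $k_i$ need not be increasing), and $0_i$ is the image of the origin of this cell and is free in $Y_i$ (it has a neighbourhood in $Y_i$ homeomorphic to $e^{k_i}/G_i$). **Proposition.** Assume that $Q$ is admissible and that $$\gcd\{g_{B_k}(v)\mid v\text{ is a free vertex of }B_k\}=1$$ for each $B_k$ with $\dim B_k>1$ that appears in a retraction sequence of $Q$. Then for each prime $p$ there are a retraction sequence $\{(B_i,E_i,b_i)\}_{i=1}^\ell$ of $Q$ and a building sequence $\{(Y_i,0_i)\}_{i=1}^\ell$ of $X(Q,\lambda)$ induced by it, namely $Y_i=\pi^{-1}\big(\bigcup_{j\ge \ell-i+1}U_j\big)$ and $\{0_i\}=\pi^{-1}(b_{\ell-i+1})$, where $U_j$ is $E_j$ with its faces not containing $b_j$ deleted, whose $\mathbf q$-cells $e^{k_i}/G_i$ all have even dimension $k_i=2\dim E_{\ell-i+1}$ and satisfy $\gcd\{p,|G_i|\}=1$. Moreover, provided that the vectors $\lambda(F_j)$ are primitive if $n=1$, the two sequences can be chosen so that also $\gcd\{p,g_{E_i}(b_i)\}=1$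 and $|G_i|=g_{E_{\ell-i+1}}(b_{\ell-i+1})$ for all $i$. -/

import Mathlib

open scoped NNReal Topology

noncomputable section

/-! ## Simple polytopes -/

/-- A finite system of affine inequalities `0 ≤ ⟪normal i, x⟫ + offset i` in `ℝⁿ`. -/
structure HalfspaceSystem (n : ℕ) where
  numFacets : ℕ
  normal : Fin numFacets → EuclideanSpace ℝ (Fin n)
  offset : Fin numFacets → ℝ

namespace HalfspaceSystem

variable {n : ℕ}

/-- The set of solutions. -/
def carrier (P : HalfspaceSystem n) : Set (EuclideanSpace ℝ (Fin n)) :=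
  {x | ∀ i, 0 ≤ inner ℝ (P.normal i) x + P.offset i}

/-- The part of the solution set where the `i`-th inequality is an equality. -/
def facet (P : HalfspaceSystem n) (i : Fin P.numFacets) : Set (EuclideanSpace ℝ (Fin n)) :=
  {x | x ∈ P.carrier ∧ inner ℝ (P.normal i) x + P.offset i = 0}

/-- The set of vertices. -/
def vertices (P : HalfspaceSystem n) : Set (EuclideanSpace ℝ (Fin n)) :=
  P.carrier.extremePoints ℝ

end HalfspaceSystem

/-- The dimension of (the affine span of) a set. -/
def affDim {n : ℕ} (E : Set (EuclideanSpace ℝ (Fin n))) : ℕ :=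
  Module.finrank ℝ (vectorSpan ℝ E)

/-- An `n`-dimensional simple convex polytope in `ℝⁿ`: a bounded intersection of half-spaces with
non-empty interior, whose facets `facet i` are listed without redundancy or repetition, and
such that every vertex lies on exactly `n` facets. -/
structure SimplePolytope (n : ℕ) extends HalfspaceSystem n where
  bounded : Bornology.IsBounded toHalfspaceSystem.carrier
  full_dim : (interior toHalfspaceSystem.carrier).Nonempty
  facet_nonempty : ∀ i, (toHalfspaceSystem.facet i).Nonempty
  facet_dim : ∀ i, affDim (toHalfspaceSystem.facet i) + 1 = n
  facet_injective : Function.Injective toHalfspaceSystem.facet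
  simple : ∀ v ∈ toHalfspaceSystem.vertices,
    Set.ncard {i | v ∈ toHalfspaceSystem.facet i} = n

namespace SimplePolytope

variable {n : ℕ}

/-- The number `ℓ` of vertices. -/
def numVertices (Q : SimplePolytope n) : ℕ := Q.vertices.ncard

/-- `⋂_{i ∈ I} F_i`, with the convention that the empty intersection is the whole polytope. -/
def facetInter (Q : SimplePolytope n) (I : Set (Fin Q.numFacets)) :
    Set (EuclideanSpace ℝ (Fin n)) :=
  {x | x ∈ Q.carrier ∧ ∀ i ∈ I, x ∈ Q.facet i}

/-- The (non-empty) faces: the non-empty intersections of facets, and the polytope itself. -/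
def IsFace (Q : SimplePolytope n) (E : Set (EuclideanSpace ℝ (Fin n))) : Prop :=
  E.Nonempty ∧ ∃ I : Set (Fin Q.numFacets), E = Q.facetInter I

/-- The face that contains `x` in its relative interior. -/
def faceAt (Q : SimplePolytope n) (x : EuclideanSpace ℝ (Fin n)) :
    Set (EuclideanSpace ℝ (Fin n)) :=
  Q.facetInter {i | x ∈ Q.facet i}

/-! ### Retraction sequences -/

/-- The union of the faces of the polytopal complex `B` that do not contain the vertex `v`. -/
def removeVertex (Q : SimplePolytope n) (B : Set (EuclideanSpace ℝ (Fin n)))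
    (v : EuclideanSpace ℝ (Fin n)) : Set (EuclideanSpace ℝ (Fin n)) :=
  ⋃₀ {E | Q.IsFace E ∧ E ⊆ B ∧ v ∉ E}

/-- `v` is a free vertex of the polytopal complex `B`, and `E` is the corresponding face: `v` has
an open neighbourhood `U` in `B` that is homeomorphic to `ℝ^d_{≥0}` as a manifold with corners
(the points with exactly `c` non-zero coordinates correspond to the points in the relative
interiors of `c`-dimensional faces), and `E` is a face of `B` of dimension `d` that contains `v`.
Here `d ≥ 1`, except that the vertex of a one-point complex is free with `d = 0`. -/
def IsFreeVertex (Q : SimplePolytope n) (B : Set (EuclideanSpace ℝ (Fin n)))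
    (v : EuclideanSpace ℝ (Fin n)) (E : Set (EuclideanSpace ℝ (Fin n))) : Prop :=
  v ∈ Q.vertices ∧ Q.IsFace E ∧ E ⊆ B ∧ v ∈ E ∧ (1 ≤ affDim E ∨ B = {v}) ∧
    ∃ U : Set B, IsOpen U ∧ (∃ u ∈ U, (u : EuclideanSpace ℝ (Fin n)) = v) ∧
      ∃ h : U ≃ₜ (Fin (affDim E) → ℝ≥0),
        ∀ x : U, Set.ncard {j | h x j ≠ 0} =
          affDim (Q.faceAt ((x : B) : EuclideanSpace ℝ (Fin n)))

/-- A retraction sequence `(B_k, E_k, b_k)`, `k = 1, …, ℓ` (here indexed from `0`). -/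
structure RetractionSequence (Q : SimplePolytope n) where
  B : Fin Q.numVertices → Set (EuclideanSpace ℝ (Fin n))
  E : Fin Q.numVertices → Set (EuclideanSpace ℝ (Fin n))
  b : Fin Q.numVertices → EuclideanSpace ℝ (Fin n)
  B_zero : ∀ h : 0 < Q.numVertices, B ⟨0, h⟩ = Q.carrier
  B_succ : ∀ (k : ℕ) (h : k + 1 < Q.numVertices),
    B ⟨k + 1, h⟩ = Q.removeVertex (B ⟨k, Nat.lt_of_succ_lt h⟩) (b ⟨k, Nat.lt_of_succ_lt h⟩)
  free : ∀ k, Q.IsFreeVertex (B k) (b k) (E k)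
  last : ∀ k : Fin Q.numVertices, (k : ℕ) + 1 = Q.numVertices → B k = {b k} ∧ E k = {b k}

/-- The complexes `B` that are reached from `Q` by successively removing free vertices. -/
inductive IsStage (Q : SimplePolytope n) : Set (EuclideanSpace ℝ (Fin n)) → Prop
  | base : IsStage Q Q.carrier
  | step {B : Set (EuclideanSpace ℝ (Fin n))} {v : EuclideanSpace ℝ (Fin n)}
      {E : Set (EuclideanSpace ℝ (Fin n))} (hB : IsStage Q B) (hv : Q.IsFreeVertex B v E) :
      IsStage Q (Q.removeVertex B v)

/-- `Q` is admissible if each (non-empty) complex reached by successively removing free vertices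
has a free vertex. -/
def Admissible (Q : SimplePolytope n) : Prop :=
  ∀ B, Q.IsStage B → B.Nonempty → ∃ v E, Q.IsFreeVertex B v E

/-- The open subset `U` of the face `E` obtained by deleting the faces of `E` that do not contain
the vertex `v`. -/
def openStar (Q : SimplePolytope n) (E : Set (EuclideanSpace ℝ (Fin n)))
    (v : EuclideanSpace ℝ (Fin n)) : Set (EuclideanSpace ℝ (Fin n)) :=
  E \ ⋃₀ {F | Q.IsFace F ∧ F ⊆ E ∧ v ∉ F}

/-! ### Characteristic functions and the numbers `g_E(v)` -/

/-- An `ℛ`-characteristic function: it assigns integer vectors to the facets, linearly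
independent whenever the facets have a common point. -/
structure CharFunction (Q : SimplePolytope n) where
  toFun : Fin Q.numFacets → (Fin n → ℤ)
  linearIndependent : ∀ I : Set (Fin Q.numFacets), (Q.facetInter I).Nonempty →
    LinearIndependent ℤ (fun i : I => toFun i)

end SimplePolytope

/-- A vector of a lattice that is not an integer multiple by a non-unit. -/
def IsPrimitiveVector {N : Type*} [AddCommGroup N] (u : N) : Prop :=
  ∀ (c : ℤ) (u' : N), u = c • u' → IsUnit c

open Classical in
/-- The primitive vector in the direction of a non-zero lattice vector `w` (and the junk
value `w` if there is none). -/
def primitiveVector {N : Type*} [AddCommGroup N] (w : N) : N :=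
  if h : ∃ u : N, IsPrimitiveVector u ∧ ∃ c : ℤ, 0 < c ∧ w = c • u then h.choose else w

/-- The inclusion `ℤⁿ → ℝⁿ`. -/
def latticeToReal (n : ℕ) : (Fin n → ℤ) →ₗ[ℤ] (Fin n → ℝ) :=
  (Int.castAddHom ℝ).toIntLinearMap.compLeft (Fin n)

/-- The exponential map `ℝⁿ → Tⁿ = ℝⁿ / ℤⁿ`. -/
def torusExp (n : ℕ) : (Fin n → ℝ) →+ UnitAddTorus (Fin n) :=
  (QuotientAddGroup.mk' (AddSubgroup.zmultiples (1 : ℝ))).compLeft (Fin n)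

namespace SimplePolytope.CharFunction

variable {n : ℕ} {Q : SimplePolytope n}

/-- The real span of the characteristic vectors `λ_i`, `i ∈ I`. -/
def realSpan (lam : Q.CharFunction) (I : Set (Fin Q.numFacets)) : Submodule ℝ (Fin n → ℝ) :=
  Submodule.span ℝ ((fun i => latticeToReal n (lam.toFun i)) '' I)

/-- The lattice `(span_ℤ {λ_i : E ⊆ F_i} ⊗ ℝ) ∩ ℤⁿ`. -/
def faceSublattice (lam : Q.CharFunction) (E : Set (EuclideanSpace ℝ (Fin n))) :
    Submodule ℤ (Fin n → ℤ) :=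
  ((lam.realSpan {i | E ⊆ Q.facet i}).restrictScalars ℤ).comap (latticeToReal n)

/-- The target `ℤⁿ / ((span_ℤ {λ_i : E ⊆ F_i} ⊗ ℝ) ∩ ℤⁿ)` of `ρ_E`. -/
abbrev FaceLattice (lam : Q.CharFunction) (E : Set (EuclideanSpace ℝ (Fin n))) : Type :=
  (Fin n → ℤ) ⧸ lam.faceSublattice E

/-- The projection `ρ_E`. -/
def rho (lam : Q.CharFunction) (E : Set (EuclideanSpace ℝ (Fin n))) :
    (Fin n → ℤ) →ₗ[ℤ] lam.FaceLattice E :=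
  (lam.faceSublattice E).mkQ

open Classical in
/-- The induced characteristic vector `λ_E(E ∩ F_j)`: the primitive vector of `ρ_E(λ(F_j))` if `E`
is a proper face, and `λ(F_j)` itself if `E` is the whole polytope. -/
def inducedVector (lam : Q.CharFunction) (E : Set (EuclideanSpace ℝ (Fin n)))
    (j : Fin Q.numFacets) : lam.FaceLattice E :=
  if E = Q.carrier then lam.rho E (lam.toFun j) else primitiveVector (lam.rho E (lam.toFun j))

open Classical in
/-- The number `g_E(v) = |det [λ_E(E ∩ F_j)]_j|`, where `F_j` runs over the facets that contain
`v` but not `E`; the determinant is taken with respect to any basis of the free module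
`FaceLattice E` (the absolute value does not depend on it). -/
def g (lam : Q.CharFunction) (E : Set (EuclideanSpace ℝ (Fin n)))
    (v : EuclideanSpace ℝ (Fin n)) : ℕ :=
  if h : Nonempty (Module.Basis {j : Fin Q.numFacets // v ∈ Q.facet j ∧ ¬ E ⊆ Q.facet j} ℤ
      (lam.FaceLattice E)) then
    (h.some.det fun j => lam.inducedVector E j).natAbs
  else 0

/-- The gcd hypothesis: for each `B_k` with `dim B_k > 1` in a retraction sequence of `Q`, the
numbers `g_{B_k}(v) = g_E(v)`, for `v` a free vertex of `B_k` with corresponding face `E`, have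
no common divisor except `1`. -/
def GcdCondition (lam : Q.CharFunction) : Prop :=
  ∀ (R : Q.RetractionSequence) (k : Fin Q.numVertices),
    (∃ F, Q.IsFace F ∧ F ⊆ R.B k ∧ 1 < affDim F) →
    ∀ c : ℕ, (∀ v E, Q.IsFreeVertex (R.B k) v E → c ∣ lam.g E v) → c = 1

/-! ### Toric orbifolds -/

/-- The subtorus `T_{E(x)}` generated by the `λ_i` with `x ∈ F_i`. -/
def isotropy (lam : Q.CharFunction) (x : EuclideanSpace ℝ (Fin n)) :
    AddSubgroup (UnitAddTorus (Fin n)) :=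
  (lam.realSpan {i | x ∈ Q.facet i}).toAddSubgroup.map (torusExp n)

/-- `(x, t) ∼ (y, s)` if and only if `x = y` and `s - t ∈ T_{E(x)}`. -/
def orbifoldSetoid (lam : Q.CharFunction) : Setoid (Q.carrier × UnitAddTorus (Fin n)) where
  r a c := a.1 = c.1 ∧ -a.2 + c.2 ∈ lam.isotropy a.1
  iseqv :=
    { refl := fun a => ⟨rfl, by simp [zero_mem]⟩
      symm := fun {a c} h => ⟨h.1.symm, by
        have := neg_mem h.2
        rw [h.1] at this
        simpa using this⟩
      trans := fun {a c d} h h' => ⟨h.1.trans h'.1, by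
        have h2 := h'.2
        rw [← h.1] at h2
        have := add_mem h.2 h2
        simpa using this⟩ }

/-- The toric orbifold `X(Q, λ) = Q × Tⁿ / ∼`, with the quotient topology. -/
abbrev ToricOrbifold (lam : Q.CharFunction) : Type := Quotient lam.orbifoldSetoid

/-- The orbit map `π : X(Q, λ) → Q ⊆ ℝⁿ`. -/
def orbitMap (lam : Q.CharFunction) : lam.ToricOrbifold → EuclideanSpace ℝ (Fin n) :=
  Quotient.lift (fun a => (a.1 : EuclideanSpace ℝ (Fin n))) fun _ _ h => congrArg Subtype.val h.1

end SimplePolytope.CharFunction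

/-! ## `q`-cells and building sequences -/

/-- A finite group `G` with a linear action on the closed unit disc of `ℝ^dim`, that is, with
an orthogonal representation. -/
structure DiscAction where
  dim : ℕ
  G : Type
  [group : Group G]
  [finite : Finite G]
  act : G →* (EuclideanSpace ℝ (Fin dim) ≃ₗᵢ[ℝ] EuclideanSpace ℝ (Fin dim))

namespace DiscAction

attribute [instance] DiscAction.group DiscAction.finite

/-- The orbit relation of the action on a subset of `ℝ^dim`. -/
def orbitSetoid (A : DiscAction) (S : Set (EuclideanSpace ℝ (Fin A.dim))) : Setoid S where
  r x y := ∃ g : A.G, A.act g x = y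
  iseqv :=
    { refl := fun x => ⟨1, by simp⟩
      symm := fun {x y} ⟨g, hg⟩ => ⟨g⁻¹, by rw [← hg]; simp [map_inv]⟩
      trans := fun {x y z} ⟨g, hg⟩ ⟨g', hg'⟩ => ⟨g' * g, by rw [← hg', ← hg]; simp [map_mul]⟩ }

/-- The `q`-disc: the closed unit disc modulo `G`. -/
abbrev QDisc (A : DiscAction) : Type := Quotient (A.orbitSetoid (Metric.closedBall 0 1))

/-- The boundary of the `q`-disc: the unit sphere modulo `G`. -/
abbrev QSphere (A : DiscAction) : Type := Quotient (A.orbitSetoid (Metric.sphere 0 1))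

/-- The `q`-cell: the open unit disc modulo `G`. -/
abbrev QCell (A : DiscAction) : Type := Quotient (A.orbitSetoid (Metric.ball 0 1))

/-- The inclusion of the boundary of the `q`-disc. -/
def boundary (A : DiscAction) : A.QSphere → A.QDisc :=
  Quotient.map (Set.inclusion Metric.sphere_subset_closedBall) fun _ _ h => h

/-- The image of the origin in the `q`-disc. -/
def origin (A : DiscAction) : A.QDisc := Quotient.mk _ ⟨0, by simp⟩

/-- The space obtained from `Y` by attaching the `q`-disc along a map `φ` defined on its boundary:
the quotient of `Y ⊔ QDisc` that identifies `φ x` with `x` for each boundary point `x`. -/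
abbrev Attach (A : DiscAction) {Y : Type*} (φ : A.QSphere → Y) : Type _ :=
  Quot fun (a c : Y ⊕ A.QDisc) => ∃ x : A.QSphere, a = Sum.inl (φ x) ∧ c = Sum.inr (A.boundary x)

end DiscAction

/-- A building sequence `(Y_i, 0_i)`, `i = 1, …, ℓ`, of a finite `q`-CW complex `X` with `ℓ`
`q`-cells: starting from `Y_0 = ∅`, the subspace `Y_i` of `X` is obtained from `Y_{i-1}` by
attaching one `q`-cell `e^{k_i} / G_i` (the dimensions `k_i` need not increase), `Y_ℓ = X`,
and the image `0_i` of the origin of this `q`-cell is a free special point of `Y_i`.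
The attaching of the `i`-th cell is recorded by `cell i`, `Y i.castSucc` and `Y i.succ` for
`i : Fin ℓ`. -/
structure BuildingSequence (X : Type*) [TopologicalSpace X] (ℓ : ℕ) where
  Y : Fin (ℓ + 1) → Set X
  Y_zero : Y 0 = ∅
  Y_last : Y (Fin.last ℓ) = Set.univ
  cell : Fin ℓ → DiscAction
  attachingMap : ∀ i, (cell i).QSphere → Y i.castSucc
  continuous_attachingMap : ∀ i, Continuous (attachingMap i)
  homeo : ∀ i, (cell i).Attach (attachingMap i) ≃ₜ Y i.succ
  homeo_inl : ∀ i (y : Y i.castSucc), (homeo i (Quot.mk _ (Sum.inl y)) : X) = y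
  free : ∀ i, ∃ U ∈ 𝓝 (homeo i (Quot.mk _ (Sum.inr (cell i).origin))),
    Nonempty (U ≃ₜ (cell i).QCell)

/-- The special point `0_i`. -/
def BuildingSequence.specialPoint {X : Type*} [TopologicalSpace X] {ℓ : ℕ}
    (S : BuildingSequence X ℓ) (i : Fin ℓ) : X :=
  S.homeo i (Quot.mk _ (Sum.inr (S.cell i).origin))

/-- The building sequence `S` of `X(Q, λ)` is the one given by the retraction sequence
`(B_j, E_j, b_j)`: its stages are `Y_i = π⁻¹(⋃_{j ≥ ℓ - i + 1} U_j)`, where `U_j` is `E_j` with the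
faces not containing `b_j` deleted, its special points are `0_i = π⁻¹(b_{ℓ - i + 1})`, and the
`i`-th cell has dimension `2 dim E_{ℓ - i + 1}`. (With indices starting from `0`, the
index `ℓ - i + 1` is `i.rev`.) -/
def BuildingSequence.IsInducedBy {n : ℕ} {Q : SimplePolytope n} {lam : Q.CharFunction}
    (S : BuildingSequence lam.ToricOrbifold Q.numVertices) (R : Q.RetractionSequence) : Prop :=
  ∀ i : Fin Q.numVertices,
    S.Y i.succ = lam.orbitMap ⁻¹' (⋃ j ∈ Set.Ici i.rev, Q.openStar (R.E j) (R.b j)) ∧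
    lam.orbitMap ⁻¹' {R.b i.rev} = {S.specialPoint i} ∧
    (S.cell i).dim = 2 * affDim (R.E i.rev)

end

/-!
The toric orbifold is assembled from cells by running a retraction sequence of the polytope
backwards: the complexes `B_k` of the sequence are successively filled up, and passing from
`B_{k+1}` to `B_k` attaches one `q`-cell to the preimage in the orbifold.

*Combinatorics.* Near a free vertex `v` of a complex `B` there is only one maximal face `E`
(`SimplePolytope.IsFreeVertex.subset_of_mem`), so that removing `v` removes exactly the open star of
`v` in `E` (`SimplePolytope.IsFreeVertex.openStar_eq`). A retraction sequence is chosen greedily,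
taking at each stage a free vertex with `p ∤ g_E(v)` if there is one
(`SimplePolytope.Admissible.exists_retractionSequence`). The gcd hypothesis, applied to this very
sequence, shows that there is one whenever the complex has dimension at least two. In dimension at
most one the vectors involved are primitive, and a primitive vector generates a lattice of rank one.

*Geometry.* At the vertex `v` the face `E` of dimension `d` is parametrized radially by
the part of the unit ball of `ℝ^d` in the closed orthant, such that coordinate hyperplanes
correspond to the facets of `E` at `v` and the unit sphere to the faces of `E` that do not contain
`v` (`radialPoint`). The directions of the cell, that is, lifts to `ℤⁿ` of vectors `u_j`
proportional to the classes of the characteristic vectors in the lattice `N_E` of `E`, give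
coordinates on the torus modulo the subtorus of `E` (`AngularCoordinates`). Reading absolute
values and angles of a point of `ℂ^d` in these two systems defines a map from the
closed unit disc to the orbifold (`cellMap`). Its fibres over the open star are the orbits of the
finite group `N_E / ⟨u_j⟩`, which acts on `ℂ^d` by rotations of the coordinates, and the order of
this group is the determinant `g_E(v)` if the `u_j` are the induced characteristic vectors.

*Topology.* The orbifold is Hausdorff, since it is the quotient of a compact space by a closed
equivalence relation (`t2Space_quotient_of_isClosed`). A continuous map from the disc that is
injective modulo the group on the open disc therefore exhibits the attaching of a `q`-cell, because
continuous bijections from compact spaces to Hausdorff spaces are homeomorphisms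
(`DiscAction.exists_homeo_attach`).
-/

noncomputable section

/-! ### Faces of a simple polytope and edge coordinates at a vertex -/

namespace SimplePolytope

variable {n : ℕ} {Q : SimplePolytope n}

/-- The value of the `i`-th defining affine function. -/
def slack (Q : SimplePolytope n) (i : Fin Q.numFacets) (x : EuclideanSpace ℝ (Fin n)) : ℝ :=
  inner ℝ (Q.normal i) x + Q.offset i

lemma mem_carrier_iff {x : EuclideanSpace ℝ (Fin n)} : x ∈ Q.carrier ↔ ∀ i, 0 ≤ Q.slack i x :=
  Iff.rfl

lemma mem_facet_iff {x : EuclideanSpace ℝ (Fin n)} {i : Fin Q.numFacets} :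
    x ∈ Q.facet i ↔ x ∈ Q.carrier ∧ Q.slack i x = 0 :=
  Iff.rfl

lemma continuous_slack (i : Fin Q.numFacets) : Continuous (Q.slack i) := by
  unfold slack; fun_prop

lemma slack_add (i : Fin Q.numFacets) (x w : EuclideanSpace ℝ (Fin n)) :
    Q.slack i (x + w) = Q.slack i x + inner ℝ (Q.normal i) w := by
  unfold slack; rw [inner_add_right]; ring

lemma slack_combo (i : Fin Q.numFacets) (x y : EuclideanSpace ℝ (Fin n)) {a b : ℝ}
    (hab : a + b = 1) : Q.slack i (a • x + b • y) = a * Q.slack i x + b * Q.slack i y := by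
  unfold slack
  rw [inner_add_right, inner_smul_right, inner_smul_right]
  linear_combination (-(Q.offset i)) * hab

lemma slack_pos {x : EuclideanSpace ℝ (Fin n)} {i : Fin Q.numFacets} (hx : x ∈ Q.carrier)
    (hi : x ∉ Q.facet i) : 0 < Q.slack i x :=
  lt_of_le_of_ne (hx i) fun h => hi ⟨hx, h.symm⟩

lemma isClosed_carrier : IsClosed Q.carrier := by
  have : Q.carrier = ⋂ i, {x | 0 ≤ Q.slack i x} := by ext x; simp [mem_carrier_iff]
  rw [this]
  exact isClosed_iInter fun i => isClosed_le continuous_const (continuous_slack i)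

lemma isCompact_carrier : IsCompact Q.carrier :=
  Metric.isCompact_of_isClosed_isBounded isClosed_carrier Q.bounded

lemma isClosed_facet (i : Fin Q.numFacets) : IsClosed (Q.facet i) :=
  isClosed_carrier.inter (isClosed_eq (continuous_slack i) continuous_const)

lemma facetInter_subset_carrier (I : Set (Fin Q.numFacets)) : Q.facetInter I ⊆ Q.carrier :=
  fun _ h => h.1

lemma isClosed_facetInter (I : Set (Fin Q.numFacets)) : IsClosed (Q.facetInter I) := by
  have : Q.facetInter I = Q.carrier ∩ ⋂ i ∈ I, Q.facet i := by
    ext x; simp [facetInter]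
  rw [this]
  exact isClosed_carrier.inter (isClosed_biInter fun i _ => isClosed_facet i)

lemma IsFace.isClosed {E : Set (EuclideanSpace ℝ (Fin n))} (hE : Q.IsFace E) : IsClosed E := by
  obtain ⟨-, I, rfl⟩ := hE; exact isClosed_facetInter I

lemma IsFace.subset_carrier {E : Set (EuclideanSpace ℝ (Fin n))} (hE : Q.IsFace E) :
    E ⊆ Q.carrier := by
  obtain ⟨-, I, rfl⟩ := hE; exact facetInter_subset_carrier I

lemma IsFace.isCompact {E : Set (EuclideanSpace ℝ (Fin n))} (hE : Q.IsFace E) : IsCompact E :=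
  isCompact_carrier.of_isClosed_subset hE.isClosed hE.subset_carrier

lemma IsFace.mem_iff {E : Set (EuclideanSpace ℝ (Fin n))} (hE : Q.IsFace E)
    {x : EuclideanSpace ℝ (Fin n)} :
    x ∈ E ↔ x ∈ Q.carrier ∧ ∀ i, E ⊆ Q.facet i → x ∈ Q.facet i := by
  refine ⟨fun hx => ⟨hE.subset_carrier hx, fun i hi => hi hx⟩, fun h => ?_⟩
  obtain ⟨-, I, rfl⟩ := hE
  exact ⟨h.1, fun i hi => h.2 i fun y hy => hy.2 i hi⟩

lemma isFace_carrier (h : Q.carrier.Nonempty) : Q.IsFace Q.carrier :=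
  ⟨h, ∅, by ext x; simp [facetInter]⟩

lemma mem_faceAt {x : EuclideanSpace ℝ (Fin n)} (hx : x ∈ Q.carrier) : x ∈ Q.faceAt x :=
  ⟨hx, fun _ h => h⟩

lemma isFace_faceAt {x : EuclideanSpace ℝ (Fin n)} (hx : x ∈ Q.carrier) :
    Q.IsFace (Q.faceAt x) := ⟨⟨x, mem_faceAt hx⟩, _, rfl⟩

lemma IsFace.faceAt_subset {E : Set (EuclideanSpace ℝ (Fin n))} (hE : Q.IsFace E)
    {x : EuclideanSpace ℝ (Fin n)} (hx : x ∈ E) : Q.faceAt x ⊆ E := by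
  obtain ⟨-, I, rfl⟩ := hE
  exact fun y hy => ⟨hy.1, fun i hi => hy.2 i (hx.2 i hi)⟩

lemma finite_setOf_isFace : {E | Q.IsFace E}.Finite :=
  (Set.finite_range Q.facetInter).subset fun E hE => by
    obtain ⟨-, I, rfl⟩ := hE; exact ⟨I, rfl⟩

lemma convex_carrier : Convex ℝ Q.carrier := by
  intro x hx y hy a b ha hb hab i
  change 0 ≤ Q.slack i _
  rw [slack_combo i x y hab]
  exact add_nonneg (mul_nonneg ha (hx i)) (mul_nonneg hb (hy i))

lemma IsFace.isExtreme {E : Set (EuclideanSpace ℝ (Fin n))} (hE : Q.IsFace E) :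
    IsExtreme ℝ Q.carrier E := by
  refine ⟨hE.subset_carrier, fun x hx y hy z hz hxyz => ?_⟩
  rw [hE.mem_iff] at hz ⊢
  refine ⟨hx, fun i hi => ⟨hx, ?_⟩⟩
  obtain ⟨a, b, ha, hb, hab, rfl⟩ := hxyz
  have h := (hz.2 i hi).2
  change Q.slack i _ = 0 at h
  rw [slack_combo i x y hab] at h
  change Q.slack i x = 0
  have hx' : 0 ≤ Q.slack i x := hx i
  have hy' : 0 ≤ Q.slack i y := hy i
  have : a * Q.slack i x = 0 := by nlinarith [mul_nonneg ha.le hx', mul_nonneg hb.le hy']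
  exact (mul_eq_zero.mp this).resolve_left ha.ne'

lemma IsFace.convex {E : Set (EuclideanSpace ℝ (Fin n))} (hE : Q.IsFace E) : Convex ℝ E := by
  intro x hx y hy a b ha hb hab
  rw [hE.mem_iff] at hx hy ⊢
  refine ⟨convex_carrier hx.1 hy.1 ha hb hab, fun i hi =>
    ⟨convex_carrier hx.1 hy.1 ha hb hab, ?_⟩⟩
  change Q.slack i _ = 0
  rw [slack_combo i x y hab, (mem_facet_iff.1 (hx.2 i hi)).2, (mem_facet_iff.1 (hy.2 i hi)).2]
  ring

lemma IsFace.exists_vertex_mem {E : Set (EuclideanSpace ℝ (Fin n))} (hE : Q.IsFace E) :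
    ∃ v ∈ Q.vertices, v ∈ E := by
  obtain ⟨v, hv⟩ := hE.isCompact.extremePoints_nonempty hE.1
  exact ⟨v, hE.isExtreme.extremePoints_subset_extremePoints hv, hv.1⟩

/-- A face is the convex hull of its vertices, so it is a point if it has only one vertex. -/
lemma IsFace.eq_singleton {E : Set (EuclideanSpace ℝ (Fin n))} (hE : Q.IsFace E)
    {b : EuclideanSpace ℝ (Fin n)} (hb : ∀ v ∈ Q.vertices, v ∈ E → v = b) : E = {b} := by
  have h := closure_convexHull_extremePoints hE.isCompact hE.convex
  have hsub : E.extremePoints ℝ ⊆ {b} := fun v hv =>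
    hb v (hE.isExtreme.extremePoints_subset_extremePoints hv) hv.1
  have h2 : E ⊆ {b} := by
    rw [← h]
    refine closure_minimal (convexHull_min hsub (convex_singleton b)) isClosed_singleton
  obtain ⟨v, hv, hvE⟩ := hE.exists_vertex_mem
  exact Set.Subset.antisymm h2 (by rintro _ rfl; rwa [← h2 hvE])

lemma eventually_slack_pos {v : EuclideanSpace ℝ (Fin n)} (hv : v ∈ Q.carrier)
    (w : EuclideanSpace ℝ (Fin n)) :
    ∀ᶠ t : ℝ in 𝓝 0, ∀ i, v ∉ Q.facet i → 0 < Q.slack i (v + t • w) := by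
  rw [Filter.eventually_all]
  intro i
  by_cases hi : v ∈ Q.facet i
  · simp [hi]
  have hc : Continuous fun t : ℝ => Q.slack i (v + t • w) :=
    (continuous_slack i).comp (by fun_prop)
  have h0 : 0 < Q.slack i (v + (0 : ℝ) • w) := by simpa using slack_pos hv hi
  filter_upwards [hc.continuousAt.eventually (lt_mem_nhds h0)] with t ht _ using ht

/-- The normals of the facets through a vertex span the whole space. -/
lemma eq_zero_of_inner_normal_eq_zero {v : EuclideanSpace ℝ (Fin n)} (hv : v ∈ Q.vertices)
    {w : EuclideanSpace ℝ (Fin n)} (hw : ∀ i, v ∈ Q.facet i → inner ℝ (Q.normal i) w = 0) :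
    w = 0 := by
  have hvc : v ∈ Q.carrier := hv.1
  have h1 := eventually_slack_pos hvc w
  have h2 := eventually_slack_pos hvc (-w)
  obtain ⟨t, ⟨ht1, ht2⟩, ht⟩ := ((h1.and h2).filter_mono nhdsWithin_le_nhds |>.and
    (self_mem_nhdsWithin : Set.Ioi (0 : ℝ) ∈ 𝓝[>] 0)).exists
  have key : ∀ s : ℝ, (∀ i, v ∉ Q.facet i → 0 < Q.slack i (v + s • w)) →
      v + s • w ∈ Q.carrier := by
    intro s hs i
    by_cases hi : v ∈ Q.facet i
    · change 0 ≤ Q.slack i _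
      rw [slack_add, (mem_facet_iff.1 hi).2, inner_smul_right, hw i hi]; simp
    · exact (hs i hi).le
  have hp := key t ht1
  have hm := key (-t) (fun i hi => by simpa using ht2 i hi)
  have := hv.2 hm hp ⟨1/2, 1/2, by norm_num, by norm_num, by norm_num, by module⟩
  have h3 : (-t) • w = 0 := by simpa using this
  exact (smul_eq_zero.mp h3).resolve_left (neg_ne_zero.mpr (ne_of_gt ht))

instance (v : EuclideanSpace ℝ (Fin n)) : Fintype {i // v ∈ Q.facet i} := Fintype.ofFinite _

lemma card_facets_through {v : EuclideanSpace ℝ (Fin n)} (hv : v ∈ Q.vertices) :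
    Fintype.card {i // v ∈ Q.facet i} = n := by
  have := Q.simple v hv
  rwa [← Nat.card_coe_set_eq, Set.coe_ofPred, Nat.card_eq_fintype_card] at this

/-- The linear coordinates on `ℝⁿ` given by the normals of the facets through a vertex. -/
def normalEquiv {v : EuclideanSpace ℝ (Fin n)} (hv : v ∈ Q.vertices) :
    EuclideanSpace ℝ (Fin n) ≃ₗ[ℝ] ({i // v ∈ Q.facet i} → ℝ) :=
  LinearEquiv.ofInjectiveOfFinrankEq
    (LinearMap.pi fun i : {i // v ∈ Q.facet i} => (innerₛₗ ℝ (Q.normal i)))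
    (by
      rw [← LinearMap.ker_eq_bot, LinearMap.ker_eq_bot']
      intro w hw
      exact eq_zero_of_inner_normal_eq_zero hv fun i hi => by
        simpa using congrFun hw ⟨i, hi⟩)
    (by rw [finrank_euclideanSpace_fin, Module.finrank_fintype_fun_eq_card,
      card_facets_through hv])

lemma normalEquiv_apply {v : EuclideanSpace ℝ (Fin n)} (hv : v ∈ Q.vertices)
    (w : EuclideanSpace ℝ (Fin n)) (i : {i // v ∈ Q.facet i}) :
    normalEquiv hv w i = inner ℝ (Q.normal i) w := rfl

/-- The edge vectors at a vertex: the basis dual to the normals of the facets through it. -/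
def edge {v : EuclideanSpace ℝ (Fin n)} (hv : v ∈ Q.vertices) (j : {i // v ∈ Q.facet i}) :
    EuclideanSpace ℝ (Fin n) :=
  (normalEquiv hv).symm (Pi.single j 1)

lemma inner_normal_edge {v : EuclideanSpace ℝ (Fin n)} (hv : v ∈ Q.vertices)
    (i j : {i // v ∈ Q.facet i}) :
    inner ℝ (Q.normal i) (edge hv j) = if i = j then 1 else 0 := by
  rw [← normalEquiv_apply hv, edge, LinearEquiv.apply_symm_apply, Pi.single_apply]

lemma linearIndependent_edge {v : EuclideanSpace ℝ (Fin n)} (hv : v ∈ Q.vertices) :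
    LinearIndependent ℝ (edge hv) := by
  have h := (Pi.basisFun ℝ {i // v ∈ Q.facet i}).linearIndependent.map'
    (normalEquiv hv).symm.toLinearMap (LinearEquiv.ker _)
  have e : edge hv = (normalEquiv hv).symm.toLinearMap ∘ Pi.basisFun ℝ {i // v ∈ Q.facet i} := by
    ext1 j
    simp [edge]
  rwa [e]

lemma ext_slack {v x y : EuclideanSpace ℝ (Fin n)} (hv : v ∈ Q.vertices)
    (h : ∀ i, v ∈ Q.facet i → Q.slack i x = Q.slack i y) : x = y := by
  rw [← sub_eq_zero]
  refine eq_zero_of_inner_normal_eq_zero hv fun i hi => ?_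
  have := h i hi
  unfold slack at this
  rw [inner_sub_right]
  linarith

/-- The facets through `v` that do not contain `E`; for a face `E` with vertex `v` they cut out
the facets of `E` at `v`. -/
abbrev FacetsAt (Q : SimplePolytope n) (E : Set (EuclideanSpace ℝ (Fin n)))
    (v : EuclideanSpace ℝ (Fin n)) : Type :=
  {j : Fin Q.numFacets // v ∈ Q.facet j ∧ ¬ E ⊆ Q.facet j}

instance (E : Set (EuclideanSpace ℝ (Fin n))) (v : EuclideanSpace ℝ (Fin n)) :
    Fintype (Q.FacetsAt E v) := Fintype.ofFinite _

/-- The edge vectors at `v` of a face `E`. -/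
def faceEdge {v : EuclideanSpace ℝ (Fin n)} (hv : v ∈ Q.vertices)
    (E : Set (EuclideanSpace ℝ (Fin n))) (j : Q.FacetsAt E v) : EuclideanSpace ℝ (Fin n) :=
  edge hv ⟨j, j.2.1⟩

/-- The combination of the edge vectors of `E` with the given coefficients. -/
def faceVec {v : EuclideanSpace ℝ (Fin n)} (hv : v ∈ Q.vertices)
    (E : Set (EuclideanSpace ℝ (Fin n))) : (Q.FacetsAt E v → ℝ) →ₗ[ℝ] EuclideanSpace ℝ (Fin n) :=
  Fintype.linearCombination ℝ (faceEdge hv E)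

section faceVec

variable {v : EuclideanSpace ℝ (Fin n)} (hv : v ∈ Q.vertices)
  {E : Set (EuclideanSpace ℝ (Fin n))}

lemma inner_normal_faceVec (y : Q.FacetsAt E v → ℝ) (j : Q.FacetsAt E v) :
    inner ℝ (Q.normal j) (faceVec hv E y) = y j := by
  rw [faceVec, Fintype.linearCombination_apply, inner_sum, Finset.sum_eq_single j]
  · rw [inner_smul_right, faceEdge, inner_normal_edge hv ⟨j, j.2.1⟩]; simp
  · intro k _ hk
    rw [inner_smul_right, faceEdge, inner_normal_edge hv ⟨j, j.2.1⟩, if_neg, mul_zero]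
    intro h
    exact hk (Subtype.ext (congrArg Subtype.val h).symm)
  · simp

lemma inner_normal_faceVec_of_subset (hvE : v ∈ E) (y : Q.FacetsAt E v → ℝ)
    {i : Fin Q.numFacets} (hi : E ⊆ Q.facet i) :
    inner ℝ (Q.normal i) (faceVec hv E y) = 0 := by
  rw [faceVec, Fintype.linearCombination_apply, inner_sum]
  refine Finset.sum_eq_zero fun k _ => ?_
  rw [inner_smul_right, faceEdge, inner_normal_edge hv ⟨i, hi hvE⟩, if_neg, mul_zero]
  intro h
  have h' := congrArg Subtype.val h
  simp only at h'
  exact k.2.2 (h' ▸ hi)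

lemma slack_faceVec (y : Q.FacetsAt E v → ℝ) (j : Q.FacetsAt E v) :
    Q.slack j (v + faceVec hv E y) = y j := by
  rw [slack_add, inner_normal_faceVec, (mem_facet_iff.1 j.2.1).2, zero_add]

lemma slack_faceVec_of_subset (hvE : v ∈ E) (y : Q.FacetsAt E v → ℝ)
    {i : Fin Q.numFacets} (hi : E ⊆ Q.facet i) :
    Q.slack i (v + faceVec hv E y) = 0 := by
  rw [slack_add, inner_normal_faceVec_of_subset hv hvE y hi, (mem_facet_iff.1 (hi hvE)).2,
    zero_add]

/-- Each point of `E` has edge coordinates at `v`, namely the values of the defining functions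
of the facets through `v`. -/
lemma eq_add_faceVec {x : EuclideanSpace ℝ (Fin n)} (hvE : v ∈ E) (hx : x ∈ E) :
    x = v + faceVec hv E fun j => Q.slack j x := by
  refine ext_slack hv fun i hi => ?_
  by_cases h : E ⊆ Q.facet i
  · rw [slack_faceVec_of_subset hv hvE _ h, (mem_facet_iff.1 (h hx)).2]
  · exact (slack_faceVec hv (fun j => Q.slack j x) ⟨i, hi, h⟩).symm

lemma add_faceVec_mem (hE : Q.IsFace E) (hvE : v ∈ E) {y : Q.FacetsAt E v → ℝ}
    (hy : ∀ j, 0 ≤ y j) (h : ∀ i, v ∉ Q.facet i → 0 ≤ Q.slack i (v + faceVec hv E y)) :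
    v + faceVec hv E y ∈ E := by
  have hc : v + faceVec hv E y ∈ Q.carrier := by
    intro i
    change 0 ≤ Q.slack i _
    by_cases hi : v ∈ Q.facet i
    · by_cases h' : E ⊆ Q.facet i
      · rw [slack_faceVec_of_subset hv hvE _ h']
      · exact (hy ⟨i, hi, h'⟩).trans_eq (slack_faceVec hv y ⟨i, hi, h'⟩).symm
    · exact h i hi
  rw [hE.mem_iff]
  exact ⟨hc, fun i hi => ⟨hc, slack_faceVec_of_subset hv hvE _ hi⟩⟩

include hv in
lemma affDim_eq_card (hE : Q.IsFace E) (hvE : v ∈ E) :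
    affDim E = Fintype.card (Q.FacetsAt E v) := by
  have hspan : vectorSpan ℝ E = Submodule.span ℝ (Set.range (faceEdge hv E)) := by
    rw [vectorSpan_eq_span_vsub_set_right ℝ hvE]
    apply le_antisymm
    · rw [Submodule.span_le]
      rintro _ ⟨x, hx, rfl⟩
      have := eq_add_faceVec hv hvE hx
      rw [faceVec, Fintype.linearCombination_apply] at this
      simp only [vsub_eq_sub]
      rw [this, add_sub_cancel_left]
      exact Submodule.sum_mem _ fun j _ => Submodule.smul_mem _ _ (Submodule.subset_span ⟨j, rfl⟩)
    · rw [Submodule.span_le]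
      rintro _ ⟨j, rfl⟩
      classical
      have hvc : v ∈ Q.carrier := hv.1
      obtain ⟨t, ht, ht0⟩ := ((eventually_slack_pos hvc (faceEdge hv E j)).filter_mono
        nhdsWithin_le_nhds |>.and (self_mem_nhdsWithin : Set.Ioi (0 : ℝ) ∈ 𝓝[>] 0)).exists
      have ht0' : (0 : ℝ) < t := ht0
      have e : faceVec hv E (Pi.single j t) = t • faceEdge hv E j := by
        simp [faceVec]
      have hmem : v + t • faceEdge hv E j ∈ E := by
        rw [← e]
        refine add_faceVec_mem hv hE hvE ?_ ?_
        · intro k; rw [Pi.single_apply]; split_ifs <;> linarith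
        · intro i hi; rw [e]; exact (ht i hi).le
      have h2 : t • faceEdge hv E j ∈ Submodule.span ℝ ((fun x => x -ᵥ v) '' E) :=
        Submodule.subset_span ⟨_, hmem, by simp⟩
      simpa [smul_smul, inv_mul_cancel₀ ht0'.ne'] using
        Submodule.smul_mem _ t⁻¹ h2
  rw [affDim, hspan]
  refine finrank_span_eq_card ?_
  refine (linearIndependent_edge hv).comp (fun j : Q.FacetsAt E v => ⟨j, j.2.1⟩) ?_
  intro a b hab
  simpa [Subtype.ext_iff] using hab

include hv in
/-- Arbitrarily close to a vertex of a face there are points in the relative interior of the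
face. -/
lemma exists_faceAt_eq (hE : Q.IsFace E) (hvE : v ∈ E) {U : Set (EuclideanSpace ℝ (Fin n))}
    (hU : U ∈ 𝓝 v) : ∃ x ∈ U, x ∈ E ∧ Q.faceAt x = E := by
  have hvc : v ∈ Q.carrier := hv.1
  set w := faceVec hv E fun _ => 1
  have hc : Filter.Tendsto (fun t : ℝ => v + t • w) (𝓝 0) (𝓝 v) := by
    have : Continuous fun t : ℝ => v + t • w := by fun_prop
    simpa using this.tendsto 0
  obtain ⟨t, ⟨ht, htU⟩, ht0⟩ := (((eventually_slack_pos hvc w).and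
    (hc.eventually hU)).filter_mono nhdsWithin_le_nhds |>.and
      (self_mem_nhdsWithin : Set.Ioi (0 : ℝ) ∈ 𝓝[>] 0)).exists
  have ht0' : (0 : ℝ) < t := ht0
  have e : t • w = faceVec hv E fun _ => t := by
    rw [← map_smul]; congr 1; ext; simp
  have hmem : v + t • w ∈ E := by
    rw [e]
    refine add_faceVec_mem hv hE hvE (fun _ => ht0'.le) fun i hi => ?_
    rw [← e]; exact (ht i hi).le
  refine ⟨_, htU, hmem, Set.Subset.antisymm (hE.faceAt_subset hmem) fun y hy =>
    ⟨hE.subset_carrier hy, fun i hi => ?_⟩⟩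
  have hi0 : Q.slack i (v + t • w) = 0 := (mem_facet_iff.1 hi).2
  by_cases h1 : v ∈ Q.facet i
  · by_cases h2 : E ⊆ Q.facet i
    · exact h2 hy
    · rw [e, slack_faceVec hv _ ⟨i, h1, h2⟩] at hi0
      exact absurd hi0 ht0'.ne'
  · exact absurd hi0 (ht i h1).ne'

end faceVec

lemma affDim_carrier (Q : SimplePolytope n) : affDim Q.carrier = n := by
  have h := affineSpan_eq_top_of_nonempty_interior
    (s := Q.carrier) (Q.full_dim.mono (interior_mono (subset_convexHull ℝ _)))
  rw [affDim, AffineSubspace.vectorSpan_eq_top_of_affineSpan_eq_top _ _ _ h, finrank_top,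
    finrank_euclideanSpace_fin]

lemma affDim_le (E : Set (EuclideanSpace ℝ (Fin n))) : affDim E ≤ n :=
  (Submodule.finrank_le _).trans_eq (by simp)

lemma IsFace.eq_of_subset_of_affDim_eq {E F : Set (EuclideanSpace ℝ (Fin n))} (hE : Q.IsFace E)
    (hF : Q.IsFace F) (hEF : E ⊆ F) (h : affDim E = affDim F) : E = F := by
  classical
  obtain ⟨v, hv, hvE⟩ := hE.exists_vertex_mem
  rw [affDim_eq_card hv hE hvE, affDim_eq_card hv hF (hEF hvE), Fintype.card_subtype,
    Fintype.card_subtype] at h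
  have hs := Finset.eq_of_subset_of_card_le (s := Finset.univ.filter fun j =>
    v ∈ Q.facet j ∧ ¬ E ⊆ Q.facet j) (t := Finset.univ.filter fun j =>
    v ∈ Q.facet j ∧ ¬ F ⊆ Q.facet j) (fun j hj => by
      simp only [Finset.mem_filter, Finset.mem_univ, true_and] at hj ⊢
      exact ⟨hj.1, fun h => hj.2 (hEF.trans h)⟩) h.ge
  refine Set.Subset.antisymm hEF fun x hx => hE.mem_iff.2 ⟨hF.subset_carrier hx, fun i hi => ?_⟩
  by_contra hxi
  have : i ∈ Finset.univ.filter fun j => v ∈ Q.facet j ∧ ¬ F ⊆ Q.facet j := by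
    simp only [Finset.mem_filter, Finset.mem_univ, true_and]
    exact ⟨hi hvE, fun h => hxi (h hx)⟩
  rw [← hs] at this
  simp only [Finset.mem_filter, Finset.mem_univ, true_and] at this
  exact this.2 hi

end SimplePolytope

/-! ### Free vertices and retraction sequences -/

namespace SimplePolytope

variable {n : ℕ} {Q : SimplePolytope n}

/-- A subset of `Q` that is a union of faces. -/
def IsComplex (Q : SimplePolytope n) (B : Set (EuclideanSpace ℝ (Fin n))) : Prop :=
  ∀ x ∈ B, x ∈ Q.carrier ∧ Q.faceAt x ⊆ B

lemma IsComplex.subset_carrier {B : Set (EuclideanSpace ℝ (Fin n))} (hB : Q.IsComplex B) :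
    B ⊆ Q.carrier := fun x hx => (hB x hx).1

lemma isComplex_carrier : Q.IsComplex Q.carrier :=
  fun _ hx => ⟨hx, facetInter_subset_carrier _⟩

lemma isComplex_removeVertex (B : Set (EuclideanSpace ℝ (Fin n)))
    (v : EuclideanSpace ℝ (Fin n)) : Q.IsComplex (Q.removeVertex B v) := by
  rintro x ⟨F, hF, hx⟩
  exact ⟨hF.1.subset_carrier hx, fun y hy => ⟨F, hF, hF.1.faceAt_subset hx hy⟩⟩

lemma isComplex_empty : Q.IsComplex ∅ := fun _ hx => hx.elim

lemma removeVertex_subset (B : Set (EuclideanSpace ℝ (Fin n)))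
    (v : EuclideanSpace ℝ (Fin n)) : Q.removeVertex B v ⊆ B := by
  rintro x ⟨F, hF, hx⟩; exact hF.2.1 hx

lemma IsComplex.isClosed {B : Set (EuclideanSpace ℝ (Fin n))} (hB : Q.IsComplex B) :
    IsClosed B := by
  have : B = ⋃₀ {F | Q.IsFace F ∧ F ⊆ B} := by
    refine Set.Subset.antisymm (fun x hx => ⟨Q.faceAt x, ⟨isFace_faceAt (hB x hx).1,
      (hB x hx).2⟩, mem_faceAt (hB x hx).1⟩) ?_
    rintro x ⟨F, hF, hx⟩
    exact hF.2 hx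
  rw [this, Set.sUnion_eq_biUnion]
  exact ((finite_setOf_isFace (Q := Q)).subset fun F hF => hF.1).isClosed_biUnion
    fun F hF => hF.1.isClosed

lemma IsStage.isComplex {B : Set (EuclideanSpace ℝ (Fin n))} (hB : Q.IsStage B) :
    Q.IsComplex B := by
  cases hB with
  | base => exact isComplex_carrier
  | step => exact isComplex_removeVertex _ _

lemma faceAt_vertex {v : EuclideanSpace ℝ (Fin n)} (hv : v ∈ Q.vertices) : Q.faceAt v = {v} := by
  have hvc : v ∈ Q.carrier := hv.1
  refine Set.Subset.antisymm (fun x hx => ?_) (by rintro _ rfl; exact mem_faceAt hvc)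
  refine ext_slack hv fun i hi => ?_
  rw [(mem_facet_iff.1 (hx.2 i hi)).2, (mem_facet_iff.1 hi).2]

lemma isFace_singleton {v : EuclideanSpace ℝ (Fin n)} (hv : v ∈ Q.vertices) : Q.IsFace {v} := by
  rw [← faceAt_vertex hv]; exact isFace_faceAt hv.1

lemma finite_vertices : Q.vertices.Finite := by
  refine Set.Finite.of_finite_image (f := fun v => ({v} : Set (EuclideanSpace ℝ (Fin n))))
    ((finite_setOf_isFace (Q := Q)).subset ?_) Set.singleton_injective.injOn
  rintro _ ⟨v, hv, rfl⟩
  exact isFace_singleton hv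

lemma vertices_inter_removeVertex (B : Set (EuclideanSpace ℝ (Fin n)))
    (v : EuclideanSpace ℝ (Fin n)) :
    Q.vertices ∩ Q.removeVertex B v = (Q.vertices ∩ B) \ {v} := by
  ext w
  constructor
  · rintro ⟨hw, F, hF, hwF⟩
    exact ⟨⟨hw, hF.2.1 hwF⟩, by rintro rfl; exact hF.2.2 hwF⟩
  · rintro ⟨⟨hw, hwB⟩, hne⟩
    refine ⟨hw, {w}, ⟨isFace_singleton hw, by simpa using hwB, fun h => hne ?_⟩, rfl⟩
    exact h.symm

/-- The face that contains a point in its relative interior can only grow under small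
displacements of the point. -/
lemma eventually_faceAt_subset {x : EuclideanSpace ℝ (Fin n)} :
    ∀ᶠ y in 𝓝 x, Q.faceAt x ⊆ Q.faceAt y := by
  have : ∀ᶠ y in 𝓝 x, ∀ i, x ∉ Q.facet i → y ∉ Q.facet i := by
    rw [Filter.eventually_all]
    intro i
    by_cases hi : x ∈ Q.facet i
    · simp [hi]
    · filter_upwards [(isClosed_facet i).isOpen_compl.mem_nhds hi] with y hy _ using hy
  filter_upwards [this] with y hy z hz
  exact ⟨hz.1, fun i hi => hz.2 i (by by_contra h; exact hy i h hi)⟩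

/-- Near a free vertex `v` the complex coincides with the corresponding face `E`. The function
`faceAt` is locally constant on the preimage of the open orthant, because there all faces have
the same dimension. As this preimage is connected and meets the interior of `E`, it lies in `E`,
and its closure is a neighbourhood of `v`. -/
lemma IsFreeVertex.subset_of_mem {B : Set (EuclideanSpace ℝ (Fin n))}
    {v : EuclideanSpace ℝ (Fin n)} {E F : Set (EuclideanSpace ℝ (Fin n))}
    (h : Q.IsFreeVertex B v E) (hB : Q.IsComplex B) (hF : Q.IsFace F) (hFB : F ⊆ B)
    (hvF : v ∈ F) : F ⊆ E := by
  obtain ⟨hv, hE, hEB, hvE, -, U, hU, ⟨u, huU, rfl⟩, h, hh⟩ := h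
  obtain ⟨V, hV, rfl⟩ := isOpen_induced_iff.1 hU
  let pt : (Fin (affDim E) → ℝ≥0) → EuclideanSpace ℝ (Fin n) := fun y => ((h.symm y : _) : B)
  have hpt : Continuous pt :=
    continuous_subtype_val.comp (continuous_subtype_val.comp h.symm.continuous)
  let O : Set (Fin (affDim E) → ℝ≥0) := Set.pi Set.univ fun _ => Set.Ioi 0
  have hdim : ∀ y ∈ O, affDim (Q.faceAt (pt y)) = affDim E := by
    intro y hy
    rw [← hh (h.symm y), h.apply_symm_apply]
    have : {j | y j ≠ 0} = Set.univ := by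
      ext j; simpa [pos_iff_ne_zero] using hy j trivial
    rw [this, Set.ncard_univ, Nat.card_fin]
  have hO : IsPreconnected O := isPreconnected_univ_pi fun _ => isPreconnected_Ioi
  have hptc : ∀ y, pt y ∈ Q.carrier := fun y => hB.subset_carrier (h.symm y : B).2
  have hloc : IsLocallyConstant fun y : O => Q.faceAt (pt y) := by
    rw [IsLocallyConstant.iff_eventually_eq]
    intro y
    have hc : Continuous fun y : O => pt y := hpt.comp continuous_subtype_val
    filter_upwards [hc.continuousAt.eventually eventually_faceAt_subset] with z hz
    exact ((isFace_faceAt (hptc _)).eq_of_subset_of_affDim_eq (isFace_faceAt (hptc _)) hz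
      (by rw [hdim y y.2, hdim z z.2])).symm
  have hall : ∀ x (hx : x ∈ B) (hxV : x ∈ V), ∃ y, pt y = x := fun x hx hxV =>
    ⟨h ⟨⟨x, hx⟩, hxV⟩, by simp [pt]⟩
  -- a point in the relative interior of `E` close to `v` lies in the open orthant
  obtain ⟨x₀, hx₀V, hx₀E, hx₀⟩ := exists_faceAt_eq hv hE hvE (hV.mem_nhds huU)
  obtain ⟨y₀, rfl⟩ := hall x₀ (hEB hx₀E) hx₀V
  have hy₀ : y₀ ∈ O := by
    have h1 := hh (h.symm y₀)
    rw [h.apply_symm_apply] at h1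
    change _ = affDim (Q.faceAt (pt y₀)) at h1
    rw [hx₀] at h1
    have h2 : {j | y₀ j ≠ 0} = Set.univ := by
      refine Set.eq_of_subset_of_ncard_le (Set.subset_univ _) ?_
      rw [h1, Set.ncard_univ, Nat.card_fin]
    intro j _
    have : j ∈ {j | y₀ j ≠ 0} := h2 ▸ Set.mem_univ j
    exact pos_iff_ne_zero.2 this
  have hOE : O ⊆ pt ⁻¹' E := by
    intro y hy
    have : PreconnectedSpace O := isPreconnected_iff_preconnectedSpace.1 hO
    have h1 := hloc.apply_eq_of_preconnectedSpace ⟨y, hy⟩ ⟨y₀, hy₀⟩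
    simp only [hx₀] at h1
    change pt y ∈ E
    rw [← h1]
    exact mem_faceAt (hptc y)
  have hcl : closure O = Set.univ := by
    rw [closure_pi_set]
    ext y
    simp [closure_Ioi]
  obtain ⟨x, hxV, hxF, hx⟩ := exists_faceAt_eq hv hF hvF (hV.mem_nhds huU)
  obtain ⟨y, rfl⟩ := hall x (hFB hxF) hxV
  have hyE : pt y ∈ E := by
    have := closure_minimal hOE (hE.isClosed.preimage hpt)
    rw [hcl] at this
    exact this (Set.mem_univ y)
  rw [← hx]
  exact hE.faceAt_subset hyE

lemma mem_openStar_iff {E : Set (EuclideanSpace ℝ (Fin n))} (hE : Q.IsFace E)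
    {v x : EuclideanSpace ℝ (Fin n)} :
    x ∈ Q.openStar E v ↔ x ∈ E ∧ v ∈ Q.faceAt x := by
  refine and_congr_right fun hx => ⟨fun h => ?_, fun h => ?_⟩
  · by_contra hv
    exact h ⟨_, ⟨isFace_faceAt (hE.subset_carrier hx), hE.faceAt_subset hx, hv⟩,
      mem_faceAt (hE.subset_carrier hx)⟩
  · rintro ⟨F, ⟨hF, -, hvF⟩, hxF⟩
    exact hvF (hF.faceAt_subset hxF h)

lemma mem_removeVertex_iff {B : Set (EuclideanSpace ℝ (Fin n))} (hB : Q.IsComplex B)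
    {v x : EuclideanSpace ℝ (Fin n)} :
    x ∈ Q.removeVertex B v ↔ x ∈ B ∧ v ∉ Q.faceAt x := by
  refine ⟨?_, fun ⟨hx, hv⟩ => ⟨_, ⟨isFace_faceAt (hB x hx).1, (hB x hx).2, hv⟩,
    mem_faceAt (hB x hx).1⟩⟩
  rintro ⟨F, ⟨hF, hFB, hvF⟩, hxF⟩
  exact ⟨hFB hxF, fun h => hvF (hF.faceAt_subset hxF h)⟩

lemma mem_faceAt_iff {v x : EuclideanSpace ℝ (Fin n)} (hv : v ∈ Q.carrier) :
    v ∈ Q.faceAt x ↔ ∀ i, x ∈ Q.facet i → v ∈ Q.facet i :=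
  ⟨fun h => h.2, fun h => ⟨hv, h⟩⟩

/-- Removing a free vertex from a complex removes exactly the open star of the vertex in the
corresponding face. -/
lemma IsFreeVertex.openStar_eq {B : Set (EuclideanSpace ℝ (Fin n))}
    {v : EuclideanSpace ℝ (Fin n)} {E : Set (EuclideanSpace ℝ (Fin n))}
    (h : Q.IsFreeVertex B v E) (hB : Q.IsComplex B) :
    Q.openStar E v = B \ Q.removeVertex B v := by
  ext x
  rw [mem_openStar_iff h.2.1, Set.mem_sdiff, mem_removeVertex_iff hB]
  constructor
  · exact fun hx => ⟨h.2.2.1 hx.1, fun h' => h'.2 hx.2⟩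
  · rintro ⟨hx, h'⟩
    have hv : v ∈ Q.faceAt x := by by_contra hv; exact h' ⟨hx, hv⟩
    exact ⟨h.subset_of_mem hB (isFace_faceAt (hB x hx).1) (hB x hx).2 hv
      (mem_faceAt (hB x hx).1), hv⟩

namespace RetractionSequence

variable (R : Q.RetractionSequence)

lemma isComplex (k : Fin Q.numVertices) : Q.IsComplex (R.B k) := by
  obtain ⟨k, hk⟩ := k
  cases k with
  | zero => rw [R.B_zero hk]; exact isComplex_carrier
  | succ k => rw [R.B_succ k hk]; exact isComplex_removeVertex _ _

open Classical in
/-- The complexes of a retraction sequence, continued by `∅` after the last one. -/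
def stage (k : ℕ) : Set (EuclideanSpace ℝ (Fin n)) :=
  if h : k < Q.numVertices then R.B ⟨k, h⟩ else ∅

lemma stage_of_lt (k : Fin Q.numVertices) : R.stage k = R.B k := by
  rw [stage, dif_pos k.2]

lemma stage_of_le {k : ℕ} (hk : Q.numVertices ≤ k) : R.stage k = ∅ := by
  rw [stage, dif_neg (by omega)]

lemma isComplex_stage (k : ℕ) : Q.IsComplex (R.stage k) := by
  unfold stage
  split_ifs
  · exact R.isComplex _
  · exact isComplex_empty

lemma stage_succ (k : Fin Q.numVertices) :
    R.stage (k + 1) = Q.removeVertex (R.B k) (R.b k) := by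
  by_cases h : (k : ℕ) + 1 < Q.numVertices
  · rw [stage, dif_pos h]; exact R.B_succ k h
  · rw [stage, dif_neg h, (R.last k (by omega)).1]
    symm
    rw [Set.eq_empty_iff_forall_notMem]
    rintro x ⟨F, ⟨-, hF, hb⟩, hx⟩
    have := hF hx
    rw [Set.mem_singleton_iff] at this
    exact hb (this ▸ hx)

lemma stage_succ_subset (k : Fin Q.numVertices) : R.stage (k + 1) ⊆ R.stage k := by
  rw [R.stage_succ, R.stage_of_lt]
  exact removeVertex_subset _ _

lemma openStar_eq (k : Fin Q.numVertices) :
    Q.openStar (R.E k) (R.b k) = R.stage k \ R.stage (k + 1) := by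
  rw [R.stage_succ, R.stage_of_lt]
  exact (R.free k).openStar_eq (R.isComplex k)

lemma iUnion_openStar (m : ℕ) :
    ⋃ j ∈ {j : Fin Q.numVertices | m ≤ j}, Q.openStar (R.E j) (R.b j) = R.stage m := by
  by_cases hm : Q.numVertices ≤ m
  · rw [R.stage_of_le hm]
    simp only [Set.mem_ofPred_eq, Set.iUnion_eq_empty]
    intro j hj
    exact absurd (hj.trans_lt j.2) (by omega)
  push Not at hm
  induction hm.le using Nat.decreasingInduction with
  | self =>
    omega
  | of_succ k hk ih =>
    have hs : {j : Fin Q.numVertices | k ≤ j} = insert ⟨k, hk⟩ {j : Fin Q.numVertices | k + 1 ≤ j} := by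
      ext j
      simp only [Set.mem_ofPred_eq, Set.mem_insert_iff, Fin.ext_iff]
      omega
    rw [hs, Set.biUnion_insert, R.openStar_eq]
    have : ⋃ j ∈ {j : Fin Q.numVertices | k + 1 ≤ j}, Q.openStar (R.E j) (R.b j) =
        R.stage (k + 1) := by
      by_cases hk' : k + 1 < Q.numVertices
      · exact ih hk'
      · rw [R.stage_of_le (by omega)]
        simp only [Set.mem_ofPred_eq, Set.iUnion_eq_empty]
        intro j hj
        exact absurd (hj.trans_lt j.2) (by omega)
    rw [this]
    exact Set.sdiff_union_of_subset (R.stage_succ_subset ⟨k, hk⟩)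

end RetractionSequence

/-- If `Q` is admissible, a retraction sequence can be chosen greedily: at each stage, it removes
a free vertex with a given property if there is one. -/
lemma Admissible.exists_retractionSequence (hQ : Q.Admissible)
    (P : EuclideanSpace ℝ (Fin n) → Set (EuclideanSpace ℝ (Fin n)) → Prop) :
    ∃ R : Q.RetractionSequence, ∀ k,
      (∃ v F, Q.IsFreeVertex (R.B k) v F ∧ P v F) → P (R.b k) (R.E k) := by
  classical
  have hc : ∀ B : Set (EuclideanSpace ℝ (Fin n)), ∃ c : EuclideanSpace ℝ (Fin n) ×
      Set (EuclideanSpace ℝ (Fin n)), ((∃ v F, Q.IsFreeVertex B v F) → Q.IsFreeVertex B c.1 c.2) ∧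
        ((∃ v F, Q.IsFreeVertex B v F ∧ P v F) → P c.1 c.2) := by
    intro B
    by_cases h1 : ∃ v F, Q.IsFreeVertex B v F ∧ P v F
    · obtain ⟨v, F, h⟩ := h1
      exact ⟨(v, F), fun _ => h.1, fun _ => h.2⟩
    · by_cases h2 : ∃ v F, Q.IsFreeVertex B v F
      · obtain ⟨v, F, h⟩ := h2
        exact ⟨(v, F), fun _ => h, fun h => absurd h h1⟩
      · exact ⟨(0, ∅), fun h => absurd h h2, fun h => absurd h h1⟩
  choose c hc1 hc2 using hc
  let Bs : ℕ → Set (EuclideanSpace ℝ (Fin n)) := fun k =>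
    Nat.rec Q.carrier (fun _ B => Q.removeVertex B (c B).1) k
  have key : ∀ k ≤ Q.numVertices, Q.IsStage (Bs k) ∧
      (Q.vertices ∩ Bs k).ncard = Q.numVertices - k := by
    intro k
    induction k with
    | zero =>
      refine fun _ => ⟨IsStage.base, ?_⟩
      have : Q.vertices ∩ Bs 0 = Q.vertices := Set.inter_eq_left.2 fun v hv => hv.1
      rw [this]; rfl
    | succ k ih =>
      intro hk
      obtain ⟨h1, h2⟩ := ih (by omega)
      obtain ⟨w, hw⟩ : (Q.vertices ∩ Bs k).Nonempty := by
        rw [← Set.ncard_pos (finite_vertices.inter_of_left _)]; omega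
      have hf := hc1 _ (hQ _ h1 ⟨w, hw.2⟩)
      refine ⟨IsStage.step h1 hf, ?_⟩
      change (Q.vertices ∩ Q.removeVertex (Bs k) (c (Bs k)).1).ncard = _
      have hm : (c (Bs k)).1 ∈ Q.vertices ∩ Bs k := ⟨hf.1, hf.2.2.1 hf.2.2.2.1⟩
      rw [vertices_inter_removeVertex, Set.ncard_sdiff_singleton_of_mem hm, h2]
      omega
  have hfree : ∀ k < Q.numVertices, Q.IsFreeVertex (Bs k) (c (Bs k)).1 (c (Bs k)).2 := by
    intro k hk
    obtain ⟨h1, h2⟩ := key k hk.le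
    obtain ⟨w, hw⟩ : (Q.vertices ∩ Bs k).Nonempty := by
      rw [← Set.ncard_pos (finite_vertices.inter_of_left _)]; omega
    exact hc1 _ (hQ _ h1 ⟨w, hw.2⟩)
  refine ⟨⟨fun k => Bs k, fun k => (c (Bs k)).2, fun k => (c (Bs k)).1, fun _ => rfl,
    fun _ _ => rfl, fun k => hfree k k.2, ?_⟩, fun k hk => hc2 _ hk⟩
  intro k hk
  obtain ⟨h1, h2⟩ := key k k.2.le
  have hf := hfree k k.2
  have hone : ∀ v ∈ Q.vertices, v ∈ Bs k → v = (c (Bs k)).1 := by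
    have h3 : (Q.vertices ∩ Bs k).ncard = 1 := by omega
    obtain ⟨a, ha⟩ := Set.ncard_eq_one.1 h3
    intro v hv hvB
    have e1 : v ∈ ({a} : Set _) := ha ▸ ⟨hv, hvB⟩
    have e2 : (c (Bs k)).1 ∈ ({a} : Set _) := ha ▸ ⟨hf.1, hf.2.2.1 hf.2.2.2.1⟩
    rw [Set.mem_singleton_iff] at e1 e2
    rw [e1, e2]
  refine ⟨Set.Subset.antisymm (fun x hx => ?_) ?_,
    hf.2.1.eq_singleton fun v hv hvE => hone v hv (hf.2.2.1 hvE)⟩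
  · have hx' := h1.isComplex x hx
    have := (isFace_faceAt hx'.1).eq_singleton fun v hv hvE => hone v hv (hx'.2 hvE)
    rw [← this]
    exact mem_faceAt hx'.1
  · rintro _ rfl
    exact hf.2.2.1 hf.2.2.2.1

end SimplePolytope

/-! ### Quotients of compact spaces and attaching of `q`-cells -/

/-- The quotient of a compact Hausdorff space by a closed equivalence relation is Hausdorff. -/
theorem t2Space_quotient_of_isClosed {Z : Type*} [TopologicalSpace Z] [CompactSpace Z] [T2Space Z]
    (s : Setoid Z) (h : IsClosed {p : Z × Z | s p.1 p.2}) : T2Space (Quotient s) := by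
  have hsat : ∀ C : Set Z, IsClosed C → IsClosed {y | ∃ x ∈ C, s x y} := by
    intro C hC
    have : {y | ∃ x ∈ C, s x y} = Prod.snd '' ({p : Z × Z | s p.1 p.2} ∩ Prod.fst ⁻¹' C) := by
      ext y
      constructor
      · rintro ⟨x, hx, hxy⟩
        exact ⟨(x, y), ⟨hxy, hx⟩, rfl⟩
      · rintro ⟨⟨x, y⟩, ⟨hxy, hx⟩, rfl⟩
        exact ⟨x, hx, hxy⟩
    rw [this]
    exact ((h.inter (hC.preimage continuous_fst)).isCompact.image continuous_snd).isClosed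
  have hopen : ∀ U : Set Z, IsOpen U →
      IsOpen {q : Quotient s | ∀ z, Quotient.mk s z = q → z ∈ U} := by
    intro U hU
    rw [← isQuotientMap_quotient_mk'.isOpen_preimage, ← isClosed_compl_iff]
    convert hsat _ hU.isClosed_compl using 1
    ext y
    simp only [Set.mem_compl_iff, Set.mem_preimage, Set.mem_ofPred_eq, not_forall, exists_prop]
    exact ⟨fun ⟨z, hz, hzU⟩ => ⟨z, hzU, Quotient.exact hz⟩,
      fun ⟨z, hzU, hz⟩ => ⟨z, Quotient.sound hz, hzU⟩⟩
  refine ⟨fun q₁ q₂ => ?_⟩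
  induction q₁ using Quotient.inductionOn with | _ a => ?_
  induction q₂ using Quotient.inductionOn with | _ b => ?_
  intro hne
  have hclass : ∀ a, IsClosed {y | s a y} := fun a => by
    simpa using hsat {a} isClosed_singleton
  obtain ⟨U, V, hU, hV, hAU, hBV, hUV⟩ := SeparatedNhds.of_isCompact_isCompact
    (hclass a).isCompact (hclass b).isCompact (Set.disjoint_left.2 fun z hz hz' =>
      hne (Quotient.sound (s.trans hz (s.symm hz'))))
  refine ⟨_, _, hopen U hU, hopen V hV, fun z hz => hAU (s.symm (Quotient.exact hz)),
    fun z hz => hBV (s.symm (Quotient.exact hz)), Set.disjoint_left.2 fun q => ?_⟩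
  induction q using Quotient.inductionOn with | _ c => ?_
  intro h1 h2
  exact Set.disjoint_left.1 hUV (h1 c rfl) (h2 c rfl)

namespace DiscAction

/-- A continuous map `f` from the disc to a Hausdorff space that maps the sphere into a compact set
`Y` and induces an injection from the open `q`-cell to the complement of `Y` exhibits
`Y ∪ range f` as `Y` with a `q`-cell attached. The bijections involved are homeomorphisms
because the disc is compact. -/
theorem exists_homeo_attach (A : DiscAction) {X : Type*} [TopologicalSpace X] [T2Space X]
    {Y Y' : Set X} (hY : IsCompact Y)
    (f : Metric.closedBall (0 : EuclideanSpace ℝ (Fin A.dim)) 1 → X) (hf : Continuous f)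
    (hinv : ∀ x y, A.orbitSetoid _ x y → f x = f y)
    (hinj : ∀ x y, ‖x.1‖ < 1 → ‖y.1‖ < 1 → f x = f y → A.orbitSetoid _ x y)
    (hmem : ∀ x, f x ∈ Y ↔ ‖x.1‖ = 1) (hY' : Y' = Y ∪ Set.range f) :
    ∃ φ : A.QSphere → Y, Continuous φ ∧ ∃ h : A.Attach φ ≃ₜ Y',
      (∀ y, (h (Quot.mk _ (Sum.inl y)) : X) = y) ∧
      (h (Quot.mk _ (Sum.inr A.origin)) : X) = f ⟨0, by simp⟩ ∧
      ∃ U ∈ 𝓝 (h (Quot.mk _ (Sum.inr A.origin))), Nonempty (U ≃ₜ A.QCell) := by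
  have hball : ∀ x : Metric.closedBall (0 : EuclideanSpace ℝ (Fin A.dim)) 1,
      f x ∉ Y → ‖x.1‖ < 1 := fun x hx =>
    lt_of_le_of_ne (mem_closedBall_zero_iff.1 x.2) fun h => hx ((hmem x).2 h)
  have hfY' : ∀ x, f x ∈ Y' := fun x => hY' ▸ Or.inr ⟨x, rfl⟩
  have hYY' : Y ⊆ Y' := hY' ▸ Set.subset_union_left
  let φ : A.QSphere → Y := Quotient.lift
    (fun x => ⟨f (Set.inclusion Metric.sphere_subset_closedBall x), (hmem _).2 (by simp)⟩)
    fun x y hxy => Subtype.ext (hinv _ _ hxy)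
  have hφ : Continuous φ := Continuous.quotient_lift
    ((hf.comp (continuous_inclusion _)).subtype_mk _) _
  let fq : A.QDisc → Y' := Quotient.lift (fun x => ⟨f x, hfY' x⟩)
    fun x y hxy => Subtype.ext (hinv _ _ hxy)
  have hfq : Continuous fq := Continuous.quotient_lift (hf.subtype_mk _) _
  let F : A.Attach φ → Y' := Quot.lift (Sum.elim (Set.inclusion hYY') fq) (by
    rintro _ _ ⟨x, rfl, rfl⟩
    induction x using Quotient.inductionOn with | _ x => rfl)
  have hF : Continuous F := continuous_quot_lift _
    ((continuous_inclusion _).sumElim hfq)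
  have hsph : ∀ x : Metric.closedBall (0 : EuclideanSpace ℝ (Fin A.dim)) 1, ∀ hx : f x ∈ Y,
      (Quot.mk _ (Sum.inr (Quotient.mk _ x)) : A.Attach φ) = Quot.mk _ (Sum.inl ⟨f x, hx⟩) := by
    intro x hx
    refine (Quot.sound ⟨Quotient.mk _ ⟨x.1, by simpa using (hmem x).1 hx⟩, rfl, rfl⟩).symm
  have hFinj : Function.Injective F := by
    have hlr : ∀ (y : Y) (x : Metric.closedBall (0 : EuclideanSpace ℝ (Fin A.dim)) 1),
        f x = y → (Quot.mk _ (Sum.inr (Quotient.mk _ x)) : A.Attach φ) =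
          Quot.mk _ (Sum.inl y) := by
      intro y x h
      rw [hsph x (h ▸ y.2)]
      congr 2
      exact Subtype.ext h
    rintro ⟨y₁ | q₁⟩ ⟨y₂ | q₂⟩ h
    · have h' : y₁ = y₂ := Subtype.ext (congrArg (fun y : Y' => (y : X)) h)
      rw [h']
    · induction q₂ using Quotient.inductionOn with | _ x => ?_
      exact (hlr y₁ x (congrArg Subtype.val h).symm).symm
    · induction q₁ using Quotient.inductionOn with | _ x => ?_
      exact hlr y₂ x (congrArg Subtype.val h)
    · induction q₁ using Quotient.inductionOn with | _ x₁ => ?_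
      induction q₂ using Quotient.inductionOn with | _ x₂ => ?_
      have h' : f x₁ = f x₂ := congrArg Subtype.val h
      by_cases hx : f x₁ ∈ Y
      · exact (hsph x₁ hx).trans (hlr ⟨f x₁, hx⟩ x₂ h'.symm).symm
      · have := hinj x₁ x₂ (hball _ hx) (hball _ (h' ▸ hx)) h'
        exact congrArg (fun q => Quot.mk _ (Sum.inr q)) (Quotient.sound this)
  have hFsurj : Function.Surjective F := by
    rintro ⟨y, hy⟩
    have hy2 := hy
    rw [hY'] at hy2
    rcases hy2 with hy2 | ⟨x, rfl⟩
    · exact ⟨Quot.mk _ (Sum.inl ⟨y, hy2⟩), rfl⟩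
    · exact ⟨Quot.mk _ (Sum.inr (Quotient.mk _ x)), rfl⟩
  have : CompactSpace Y := isCompact_iff_compactSpace.1 hY
  have : CompactSpace (Metric.closedBall (0 : EuclideanSpace ℝ (Fin A.dim)) 1) :=
    isCompact_iff_compactSpace.1 (isCompact_closedBall _ _)
  have : CompactSpace (A.Attach φ) := Quot.compactSpace
  let h : A.Attach φ ≃ₜ Y' :=
    Continuous.homeoOfEquivCompactToT2 (f := Equiv.ofBijective F ⟨hFinj, hFsurj⟩) hF
  refine ⟨φ, hφ, h, fun y => rfl, rfl, {y | (y : X) ∉ Y}, ?_, ?_⟩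
  · refine (hY.isClosed.preimage continuous_subtype_val).isOpen_compl.mem_nhds ?_
    change f _ ∉ Y
    rw [hmem]
    simp
  · let U : Set Y' := {y | (y : X) ∉ Y}
    have hbc : Metric.ball (0 : EuclideanSpace ℝ (Fin A.dim)) 1 ⊆ Metric.closedBall 0 1 :=
      Metric.ball_subset_closedBall
    have hfU : ∀ x : Metric.ball (0 : EuclideanSpace ℝ (Fin A.dim)) 1,
        f (Set.inclusion hbc x) ∉ Y := fun x hx => by
      have h1 := (hmem _).1 hx
      have h2 : ‖x.1‖ < 1 := mem_ball_zero_iff.1 x.2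
      exact h2.ne h1
    let g : A.QCell → U := Quotient.lift
      (fun x => ⟨⟨f (Set.inclusion hbc x), hfY' _⟩, hfU x⟩)
      fun x y hxy => Subtype.ext (Subtype.ext (hinv _ _ hxy))
    have hg : Continuous g := Continuous.quotient_lift
      (((hf.comp (continuous_inclusion _)).subtype_mk _).subtype_mk _) _
    have hginj : Function.Injective g := by
      intro q₁ q₂ hq
      induction q₁ using Quotient.inductionOn with | _ x₁ => ?_
      induction q₂ using Quotient.inductionOn with | _ x₂ => ?_
      have h' : f (Set.inclusion hbc x₁) = f (Set.inclusion hbc x₂) :=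
        congrArg (fun u : U => ((u : Y') : X)) hq
      exact Quotient.sound (hinj _ _ (hball _ (hfU x₁)) (hball _ (hfU x₂)) h')
    have hgsurj : Function.Surjective g := by
      rintro ⟨⟨y, hy⟩, hyY⟩
      have hy2 := hy
      rw [hY'] at hy2
      obtain ⟨x, rfl⟩ := hy2.resolve_left hyY
      exact ⟨Quotient.mk _ ⟨x.1, by simpa using hball x hyY⟩, rfl⟩
    have hgcl : IsClosedMap g := by
      intro K hK
      have hK' := hK.preimage (continuous_quotient_mk' (s := A.orbitSetoid (Metric.ball 0 1)))
      obtain ⟨C, hC, hCK⟩ := isClosed_induced_iff.1 hK'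
      have hcl : IsClosed (f '' (Subtype.val ⁻¹' C)) :=
        ((hC.preimage continuous_subtype_val).isCompact.image hf).isClosed
      convert (hcl.preimage continuous_subtype_val).preimage
        (continuous_subtype_val (p := fun y => y ∈ U)) using 1
      ext u
      constructor
      · rintro ⟨q, hq, rfl⟩
        induction q using Quotient.inductionOn with | _ x => ?_
        refine ⟨Set.inclusion hbc x, ?_, rfl⟩
        have : x ∈ Subtype.val ⁻¹' C := hCK ▸ hq
        exact this
      · rintro ⟨x, hx, hxu⟩
        have hx1 : ‖x.1‖ < 1 := hball x (hxu ▸ u.2)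
        refine ⟨Quotient.mk _ ⟨x.1, by simpa using hx1⟩, ?_, Subtype.ext (Subtype.ext hxu)⟩
        have : (⟨x.1, by simpa using hx1⟩ : Metric.ball (0 : EuclideanSpace ℝ (Fin A.dim)) 1) ∈
          Subtype.val ⁻¹' C := hx
        rw [hCK] at this
        exact this
    exact ⟨((Equiv.ofBijective g ⟨hginj, hgsurj⟩).toHomeomorphOfContinuousClosed hg hgcl).symm⟩

end DiscAction

/-! ### Lattices and primitive vectors -/

lemma latticeToReal_apply {n : ℕ} (m : Fin n → ℤ) (k : Fin n) :
    latticeToReal n m k = (m k : ℝ) := rfl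

lemma latticeToReal_injective (n : ℕ) : Function.Injective (latticeToReal n) := by
  intro a b h
  ext k
  have := congrFun h k
  simpa [latticeToReal_apply] using this

/-- Integer vectors that are independent over `ℤ` are independent over `ℝ`; it suffices to treat
`n` vectors in `ℤⁿ`, where independence is detected by the determinant. -/
lemma LinearIndependent.latticeToReal {n : ℕ} {ι : Type*} [Fintype ι]
    (hcard : Fintype.card ι = n) {w : ι → Fin n → ℤ} (hw : LinearIndependent ℤ w) :
    LinearIndependent ℝ fun i => _root_.latticeToReal n (w i) := by
  let e : Fin n ≃ ι := (Fintype.equivFinOfCardEq hcard).symm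
  let M : Matrix (Fin n) (Fin n) ℤ := Matrix.of fun i => w (e i)
  have hdet : M.det ≠ 0 := by
    rw [Ne, ← Matrix.exists_vecMul_eq_zero_iff]
    rintro ⟨a, ha, h⟩
    refine ha ?_
    have hwe := hw.comp e e.injective
    rw [Fintype.linearIndependent_iff] at hwe
    refine funext (hwe a ?_)
    ext k
    have := congrFun h k
    simpa [Matrix.vecMul, dotProduct, M] using this
  have hdet' : (M.map (Int.castRingHom ℝ)).det ≠ 0 := by
    rw [← RingHom.mapMatrix_apply, ← RingHom.map_det]
    simpa using hdet
  have h := Matrix.linearIndependent_rows_of_det_ne_zero hdet'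
  refine (linearIndependent_equiv e).1 ?_
  exact h

lemma exists_isPrimitiveVector {N ι : Type*} [AddCommGroup N] [Fintype ι]
    (b : Module.Basis ι ℤ N) {w : N} (hw : w ≠ 0) :
    ∃ u : N, IsPrimitiveVector u ∧ ∃ c : ℤ, 0 < c ∧ w = c • u := by
  classical
  have hne : (Finset.univ : Finset ι).Nonempty := by
    rw [Finset.univ_nonempty_iff]
    by_contra h
    rw [not_nonempty_iff] at h
    exact hw (b.repr.injective (Subsingleton.elim _ _))
  obtain ⟨g, hg, hg1⟩ := Finset.extract_gcd (fun i => b.repr w i) hne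
  set d := Finset.univ.gcd fun i => b.repr w i
  have hwd : w = d • ∑ i, g i • b i := by
    conv_lhs => rw [← b.sum_repr w]
    rw [Finset.smul_sum]
    refine Finset.sum_congr rfl fun i hi => ?_
    rw [hg i hi, mul_smul]
  have hd : 0 ≤ d := by
    have : normalize d = d := Finset.normalize_gcd
    exact Int.nonneg_of_normalize_eq_self this
  refine ⟨∑ i, g i • b i, ?_, d, lt_of_le_of_ne hd ?_, hwd⟩
  · intro c u' hu
    have hdvd : ∀ i, c ∣ g i := by
      intro i
      have := congrArg (fun x => b.repr x i) hu
      simp only [b.repr_sum_self] at this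
      rw [this, map_smul]
      exact ⟨b.repr u' i, by simp⟩
    have : c ∣ Finset.univ.gcd g := Finset.dvd_gcd fun i _ => hdvd i
    rw [hg1] at this
    exact isUnit_of_dvd_one this
  · intro h
    rw [← h, zero_smul] at hwd
    exact hw hwd

lemma exists_smul_primitiveVector {N : Type*} [AddCommGroup N] (w : N) :
    ∃ c : ℤ, c ≠ 0 ∧ c • primitiveVector w = w := by
  classical
  unfold primitiveVector
  split_ifs with h
  · obtain ⟨c, hc, hw⟩ := h.choose_spec.2
    exact ⟨c, hc.ne', hw.symm⟩
  · exact ⟨1, one_ne_zero, one_smul _ _⟩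

lemma isPrimitiveVector_primitiveVector {N ι : Type*} [AddCommGroup N] [Fintype ι]
    (b : Module.Basis ι ℤ N) {w : N} (hw : w ≠ 0) : IsPrimitiveVector (primitiveVector w) := by
  classical
  have h := exists_isPrimitiveVector b hw
  unfold primitiveVector
  rw [dif_pos h]
  exact h.choose_spec.1

lemma IsPrimitiveVector.map_equiv {N N' : Type*} [AddCommGroup N] [AddCommGroup N']
    (e : N ≃ₗ[ℤ] N') {u : N} (hu : IsPrimitiveVector u) : IsPrimitiveVector (e u) := by
  intro c u' h
  refine hu c (e.symm u') ?_
  rw [← map_smul, ← h, e.symm_apply_apply]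

/-- The index of the lattice spanned by independent vectors is the absolute value of their
determinant. -/
lemma card_quotient_span_range {N ι : Type*} [AddCommGroup N] [Fintype ι] [DecidableEq ι]
    (b : Module.Basis ι ℤ N) {u : ι → N} (hu : LinearIndependent ℤ u) :
    Nat.card (N ⧸ Submodule.span ℤ (Set.range u)) = (b.det u).natAbs := by
  have : Module.Free ℤ N := Module.Free.of_basis b
  have : Module.Finite ℤ N := Module.Finite.of_basis b
  rw [← Submodule.natAbs_det_basis_change b _ (Module.Basis.span hu)]
  congr 2
  ext i
  simp [Module.Basis.span_apply]

lemma natAbs_det_ne_zero {N ι : Type*} [AddCommGroup N] [Fintype ι] [DecidableEq ι]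
    (b : Module.Basis ι ℤ N) {u : ι → N} (hu : LinearIndependent ℤ u) :
    (b.det u).natAbs ≠ 0 := by
  rw [Int.natAbs_ne_zero, Module.Basis.det_apply, Ne, ← Matrix.exists_mulVec_eq_zero_iff]
  rintro ⟨a, ha, h⟩
  rw [Fintype.linearIndependent_iff] at hu
  refine ha (funext (hu a ?_))
  refine b.repr.injective (Finsupp.ext fun i => ?_)
  have := congrFun h i
  simpa [Matrix.mulVec, dotProduct, Module.Basis.toMatrix_apply, mul_comm] using this

/-- In rank at most one, primitive vectors form a basis. -/
lemma natAbs_det_eq_one_of_card_le_one {N ι : Type*} [AddCommGroup N] [Fintype ι] [DecidableEq ι]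
    (b : Module.Basis ι ℤ N) (hι : Fintype.card ι ≤ 1) {u : ι → N}
    (hu : ∀ i, IsPrimitiveVector (u i)) : (b.det u).natAbs = 1 := by
  rw [Fintype.card_le_one_iff_subsingleton] at hι
  rcases isEmpty_or_nonempty ι with h | ⟨⟨i⟩⟩
  · simp
  · have : Unique ι := uniqueOfSubsingleton i
    rw [Module.Basis.det_apply, Matrix.det_unique, Module.Basis.toMatrix_apply,
      ← Int.isUnit_iff_natAbs_eq]
    refine hu default _ (b default) ?_
    conv_lhs => rw [← b.sum_repr (u default)]
    simp

namespace SimplePolytope.CharFunction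

variable {n : ℕ} {Q : SimplePolytope n} (lam : Q.CharFunction)

/-! ### The characteristic vectors at a vertex -/

section vertexBasis

variable {v : EuclideanSpace ℝ (Fin n)} (hv : v ∈ Q.vertices)

include hv in
lemma linearIndependent_vertex :
    LinearIndependent ℝ fun i : {i // v ∈ Q.facet i} => latticeToReal n (lam.toFun i) :=
  LinearIndependent.latticeToReal (card_facets_through hv)
    (lam.linearIndependent {i | v ∈ Q.facet i} ⟨v, hv.1, fun _ h => h⟩)

/-- The characteristic vectors of the facets through a vertex, as a basis of `ℝⁿ`. -/
def vertexBasis : Module.Basis {i // v ∈ Q.facet i} ℝ (Fin n → ℝ) :=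
  Module.Basis.mk (lam.linearIndependent_vertex hv) (by
    rw [(lam.linearIndependent_vertex hv).span_eq_top_of_card_eq_finrank'
      (by rw [card_facets_through hv]; simp)])

lemma vertexBasis_apply (i : {i // v ∈ Q.facet i}) :
    lam.vertexBasis hv i = latticeToReal n (lam.toFun i) := by
  rw [vertexBasis, Module.Basis.mk_apply]

lemma mem_realSpan_iff {K : Set (Fin Q.numFacets)} (hK : K ⊆ {i | v ∈ Q.facet i})
    {y : Fin n → ℝ} :
    y ∈ lam.realSpan K ↔
      ∀ i : {i // v ∈ Q.facet i}, (i : Fin Q.numFacets) ∉ K → (lam.vertexBasis hv).repr y i = 0 := by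
  have : (fun i => latticeToReal n (lam.toFun i)) '' K =
      lam.vertexBasis hv '' {i | (i : Fin Q.numFacets) ∈ K} := by
    ext w
    constructor
    · rintro ⟨i, hi, rfl⟩
      exact ⟨⟨i, hK hi⟩, hi, lam.vertexBasis_apply hv _⟩
    · rintro ⟨i, hi, rfl⟩
      exact ⟨i, hi, (lam.vertexBasis_apply hv i).symm⟩
  rw [realSpan, this, Module.Basis.mem_span_image]
  simp only [Set.subset_def, Finset.mem_coe, Finsupp.mem_support_iff, Set.mem_ofPred_eq]
  exact ⟨fun h i hi => by_contra fun h' => hi (h i h'), fun h i hi => by_contra fun h' => hi (h i h')⟩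

variable {E : Set (EuclideanSpace ℝ (Fin n))}

/-- The `j`-th coordinate with respect to the characteristic vectors at `v`, as a function on the
quotient lattice of a face `E` with vertex `v`. -/
def faceCoord (hvE : v ∈ E) (j : Q.FacetsAt E v) : lam.FaceLattice E →ₗ[ℤ] ℝ :=
  (lam.faceSublattice E).liftQ
    ((((lam.vertexBasis hv).coord ⟨j, j.2.1⟩).restrictScalars ℤ).comp (latticeToReal n)) (by
      intro m hm
      have h : latticeToReal n m ∈ lam.realSpan {i | E ⊆ Q.facet i} := hm
      rw [lam.mem_realSpan_iff hv (Set.ofPred_subset_ofPred.2 fun i hi => hi hvE)] at h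
      exact h ⟨j, j.2.1⟩ j.2.2)

lemma faceCoord_rho (hvE : v ∈ E) (j : Q.FacetsAt E v) (m : Fin n → ℤ) :
    lam.faceCoord hv hvE j (lam.rho E m) =
      (lam.vertexBasis hv).repr (latticeToReal n m) ⟨j, j.2.1⟩ := rfl

lemma faceCoord_rho_toFun (hvE : v ∈ E) (j k : Q.FacetsAt E v) :
    lam.faceCoord hv hvE j (lam.rho E (lam.toFun k)) = if j = k then 1 else 0 := by
  classical
  have : latticeToReal n (lam.toFun k) = lam.vertexBasis hv ⟨k, k.2.1⟩ :=
    (lam.vertexBasis_apply hv ⟨k, k.2.1⟩).symm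
  rw [faceCoord_rho, this, Module.Basis.repr_self, Finsupp.single_apply]
  simp only [Subtype.ext_iff, eq_comm]

lemma rho_eq_zero_iff (hvE : v ∈ E) (m : Fin n → ℤ) :
    lam.rho E m = 0 ↔ ∀ j, lam.faceCoord hv hvE j (lam.rho E m) = 0 := by
  refine ⟨fun h j => by rw [h, map_zero], fun h => ?_⟩
  rw [rho, Submodule.mkQ_apply, Submodule.Quotient.mk_eq_zero]
  change latticeToReal n m ∈ lam.realSpan {i | E ⊆ Q.facet i}
  rw [lam.mem_realSpan_iff hv (Set.ofPred_subset_ofPred.2 fun i hi => hi hvE)]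
  exact fun i hi => h ⟨i, i.2, hi⟩

include hv in
lemma rho_toFun_ne_zero (hvE : v ∈ E) (j : Q.FacetsAt E v) :
    lam.rho E (lam.toFun j) ≠ 0 := by
  intro h
  have := lam.faceCoord_rho_toFun hv hvE j j
  rw [h, map_zero, if_pos rfl] at this
  exact zero_ne_one this

include hv in
lemma linearIndependent_of_smul_eq (hvE : v ∈ E) {u : Q.FacetsAt E v → lam.FaceLattice E}
    (hu : ∀ j, ∃ c : ℤ, c ≠ 0 ∧ c • u j = lam.rho E (lam.toFun j)) :
    LinearIndependent ℤ u := by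
  choose c hc hcu using hu
  have hcoord : ∀ j k, c k * lam.faceCoord hv hvE j (u k) = if j = k then 1 else 0 := by
    intro j k
    rw [← lam.faceCoord_rho_toFun hv hvE j k, ← hcu k, map_smul, zsmul_eq_mul]
  rw [Fintype.linearIndependent_iff]
  intro a ha j
  have h := congrArg (lam.faceCoord hv hvE j) ha
  rw [map_sum, map_zero, Finset.sum_eq_single j] at h
  · rw [map_smul, zsmul_eq_mul, mul_eq_zero] at h
    rcases h with h | h
    · exact_mod_cast h
    · have := hcoord j j
      rw [h] at this
      simp at this
  · intro k _ hk
    have := hcoord j k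
    rw [if_neg (Ne.symm hk), mul_eq_zero] at this
    rw [map_smul, this.resolve_left (by exact_mod_cast hc k), smul_zero]
  · simp

include hv in
/-- The lattice of a face has rank the dimension of the face. -/
lemma nonempty_basis_faceLattice (hvE : v ∈ E) :
    Nonempty (Module.Basis (Q.FacetsAt E v) ℤ (lam.FaceLattice E)) := by
  classical
  have : Module.IsTorsionFree ℤ (lam.FaceLattice E) := by
    refine Function.Injective.moduleIsTorsionFree (LinearMap.pi fun j => lam.faceCoord hv hvE j)
      ?_ fun c x => map_smul _ c x
    rw [← LinearMap.ker_eq_bot, LinearMap.ker_eq_bot']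
    intro m hm
    obtain ⟨m, rfl⟩ := (lam.faceSublattice E).mkQ_surjective m
    exact (lam.rho_eq_zero_iff hv hvE m).2 fun j => congrFun hm j
  have : Module.Free ℤ (lam.FaceLattice E) := Module.free_of_finite_type_torsion_free'
  have h1 := (lam.linearIndependent_of_smul_eq hv hvE
    (u := fun j => lam.rho E (lam.toFun j)) fun j => ⟨1, one_ne_zero, one_smul _ _⟩)
    |>.fintype_card_le_finrank
  have h2 : Fintype.card {i // v ∈ Q.facet i ∧ E ⊆ Q.facet i} ≤
      Module.finrank ℤ (lam.faceSublattice E) := by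
    have hli := lam.linearIndependent {i | E ⊆ Q.facet i}
      ⟨v, hv.1, fun i hi => hi hvE⟩
    have hli' : LinearIndependent ℤ fun i : {i // v ∈ Q.facet i ∧ E ⊆ Q.facet i} =>
        (⟨lam.toFun i, Submodule.subset_span ⟨i, i.2.2, rfl⟩⟩ : lam.faceSublattice E) := by
      refine LinearIndependent.of_comp (lam.faceSublattice E).subtype ?_
      exact hli.comp (fun i : {i // v ∈ Q.facet i ∧ E ⊆ Q.facet i} => ⟨i, i.2.2⟩)
        (fun a b h => Subtype.ext (by simpa using h))
    exact hli'.fintype_card_le_finrank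
  have h3 := (lam.faceSublattice E).finrank_quotient_add_finrank
  have h4 : Fintype.card (Q.FacetsAt E v) +
      Fintype.card {i // v ∈ Q.facet i ∧ E ⊆ Q.facet i} = n := by
    refine Eq.trans ?_ (card_facets_through hv)
    rw [Fintype.card_subtype, Fintype.card_subtype,
      Fintype.card_subtype, add_comm, ← Finset.filter_filter, ← Finset.filter_filter]
    exact Finset.card_filter_add_card_filter_not _
  have h5 : Module.finrank ℤ (lam.FaceLattice E) = Fintype.card (Q.FacetsAt E v) := by
    rw [Module.finrank_fin_fun] at h3
    change Module.finrank ℤ (lam.FaceLattice E) + _ = n at h3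
    omega
  exact ⟨(Module.finBasis ℤ (lam.FaceLattice E)).reindex
    (Fintype.equivFinOfCardEq h5.symm).symm⟩

include hv in
/-- The number `g_E(v)` is the index of the lattice spanned by the induced characteristic
vectors. -/
lemma card_quotient_inducedVector (hvE : v ∈ E) :
    Nat.card (lam.FaceLattice E ⧸ Submodule.span ℤ
      (Set.range fun j : Q.FacetsAt E v => lam.inducedVector E j)) = lam.g E v := by
  classical
  have hb := lam.nonempty_basis_faceLattice hv hvE
  have hli : LinearIndependent ℤ fun j : Q.FacetsAt E v => lam.inducedVector E j := by
    refine lam.linearIndependent_of_smul_eq hv hvE fun j => ?_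
    unfold inducedVector
    split_ifs
    · exact ⟨1, one_ne_zero, one_smul _ _⟩
    · exact exists_smul_primitiveVector _
  rw [card_quotient_span_range hb.some hli, g, dif_pos hb]
  congr!

end vertexBasis

end SimplePolytope.CharFunction

/-! ### The torus and the topology of the toric orbifold -/

lemma torusExp_apply {n : ℕ} (y : Fin n → ℝ) (k : Fin n) :
    torusExp n y k = ((y k : ℝ) : AddCircle (1 : ℝ)) := rfl

lemma continuous_torusExp (n : ℕ) : Continuous (torusExp n) :=
  continuous_pi fun k => (AddCircle.continuous_mk' 1).comp (continuous_apply k)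

lemma torusExp_surjective (n : ℕ) : Function.Surjective (torusExp n) := by
  intro t
  choose y hy using fun k => QuotientAddGroup.mk_surjective (t k)
  exact ⟨y, funext hy⟩

lemma torusExp_eq_zero_iff {n : ℕ} {y : Fin n → ℝ} :
    torusExp n y = 0 ↔ ∃ m : Fin n → ℤ, y = latticeToReal n m := by
  constructor
  · intro h
    have : ∀ k, ∃ m : ℤ, m • (1 : ℝ) = y k := fun k =>
      (AddCircle.coe_eq_zero_iff 1).1 (congrFun h k)
    choose m hm using this
    exact ⟨m, funext fun k => by rw [← hm k, latticeToReal_apply]; simp⟩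
  · rintro ⟨m, rfl⟩
    ext k
    exact (AddCircle.coe_eq_zero_iff 1).2 ⟨m k, by simp [latticeToReal_apply]⟩

namespace SimplePolytope.CharFunction

variable {n : ℕ} {Q : SimplePolytope n} (lam : Q.CharFunction)

/-- The subgroup of the torus generated by a set of rational directions is a continuous image of
a compact torus. -/
lemma isClosed_map_realSpan (I : Set (Fin Q.numFacets)) :
    IsClosed ((lam.realSpan I).toAddSubgroup.map (torusExp n) : Set (UnitAddTorus (Fin n))) := by
  classical
  have : Fintype I := Fintype.ofFinite _
  let f : (I → UnitAddCircle) → UnitAddTorus (Fin n) := fun θ k =>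
    ∑ i : I, lam.toFun i k • θ i
  have hf : Continuous f := continuous_pi fun k => continuous_finsetSum _ fun i _ =>
    (continuous_apply i).zsmul _
  have hfe : ∀ a : I → ℝ, f (fun i => (a i : UnitAddCircle)) =
      torusExp n (Fintype.linearCombination ℝ (fun i : I => latticeToReal n (lam.toFun i)) a) := by
    intro a
    ext k
    rw [torusExp_apply, Fintype.linearCombination_apply, Finset.sum_apply]
    simp only [f, Pi.smul_apply, latticeToReal_apply, smul_eq_mul]
    change _ = (QuotientAddGroup.mk' (AddSubgroup.zmultiples (1 : ℝ))) _
    rw [map_sum]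
    refine Finset.sum_congr rfl fun i _ => ?_
    rw [mul_comm, ← zsmul_eq_mul, map_zsmul]
    rfl
  have hspan : lam.realSpan I =
      (Fintype.linearCombination ℝ (fun i : I => latticeToReal n (lam.toFun i))).range := by
    rw [Fintype.range_linearCombination, realSpan, Set.image_eq_range]
  have : ((lam.realSpan I).toAddSubgroup.map (torusExp n) : Set (UnitAddTorus (Fin n))) =
      Set.range f := by
    rw [hspan]
    ext t
    constructor
    · rintro ⟨_, ⟨a, rfl⟩, rfl⟩
      exact ⟨fun i => (a i : UnitAddCircle), hfe a⟩
    · rintro ⟨θ, rfl⟩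
      choose a ha using fun i => QuotientAddGroup.mk_surjective (θ i)
      refine ⟨_, ⟨a, rfl⟩, ?_⟩
      rw [← hfe]
      exact congrArg f (funext ha)
  rw [this]
  exact (isCompact_range hf).isClosed

lemma realSpan_mono {I I' : Set (Fin Q.numFacets)} (h : I ⊆ I') :
    lam.realSpan I ≤ lam.realSpan I' :=
  Submodule.span_mono (Set.image_mono h)

instance : CompactSpace Q.carrier := isCompact_iff_compactSpace.1 isCompact_carrier

/-- The equivalence relation that defines the toric orbifold is closed: it is the union over the
sets `I` of facets of the closed sets where `x = y` lies on all facets in `I` and `s - t` lies in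
the subtorus defined by `I`. -/
lemma isClosed_orbifoldSetoid :
    IsClosed {p : (Q.carrier × UnitAddTorus (Fin n)) × (Q.carrier × UnitAddTorus (Fin n)) |
      lam.orbifoldSetoid p.1 p.2} := by
  have : {p : (Q.carrier × UnitAddTorus (Fin n)) × (Q.carrier × UnitAddTorus (Fin n)) |
      lam.orbifoldSetoid p.1 p.2} = ⋃ I : Set (Fin Q.numFacets),
        {p | p.1.1 = p.2.1} ∩ ({p | (p.1.1 : EuclideanSpace ℝ (Fin n)) ∈ Q.facetInter I} ∩
          {p | -p.1.2 + p.2.2 ∈ ((lam.realSpan I).toAddSubgroup.map (torusExp n) :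
            Set (UnitAddTorus (Fin n)))}) := by
    ext ⟨⟨x, t⟩, ⟨y, s⟩⟩
    simp only [Set.mem_ofPred_eq, Set.mem_iUnion, Set.mem_inter_iff]
    constructor
    · rintro ⟨h1, h2⟩
      exact ⟨{i | (x : EuclideanSpace ℝ (Fin n)) ∈ Q.facet i}, h1, ⟨x.2, fun i hi => hi⟩, h2⟩
    · rintro ⟨I, h1, h2, h3⟩
      refine ⟨h1, ?_⟩
      have hle : lam.realSpan I ≤ lam.realSpan {i | (x : EuclideanSpace ℝ (Fin n)) ∈ Q.facet i} :=
        lam.realSpan_mono h2.2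
      obtain ⟨y, hy, hy'⟩ := h3
      exact ⟨y, hle hy, hy'⟩
  rw [this]
  refine isClosed_iUnion_of_finite fun I => ?_
  refine (isClosed_eq (by fun_prop) (by fun_prop)).inter (IsClosed.inter ?_ ?_)
  · exact (isClosed_facetInter I).preimage (by fun_prop)
  · exact (lam.isClosed_map_realSpan I).preimage (by fun_prop)

instance : T2Space lam.ToricOrbifold :=
  t2Space_quotient_of_isClosed _ lam.isClosed_orbifoldSetoid

instance : CompactSpace lam.ToricOrbifold := Quotient.compactSpace

lemma continuous_orbitMap : Continuous lam.orbitMap :=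
  Continuous.quotient_lift (continuous_subtype_val.comp continuous_fst) _

lemma mk_eq_mk_iff {x y : Q.carrier} {a b : Fin n → ℝ} :
    (Quotient.mk lam.orbifoldSetoid (x, torusExp n a) = Quotient.mk _ (y, torusExp n b)) ↔
      x = y ∧ ∃ w ∈ lam.realSpan {i | (x : EuclideanSpace ℝ (Fin n)) ∈ Q.facet i},
        ∃ m : Fin n → ℤ, b - a = w + latticeToReal n m := by
  rw [Quotient.eq]
  refine and_congr_right fun _ => ?_
  have e : -torusExp n a + torusExp n b = torusExp n (b - a) := by rw [map_sub]; abel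
  change -torusExp n a + torusExp n b ∈ lam.isotropy x ↔ _
  rw [e]
  constructor
  · rintro ⟨w, hw, hwe⟩
    have : torusExp n (b - a - w) = 0 := by rw [map_sub, hwe, sub_self]
    obtain ⟨m, hm⟩ := torusExp_eq_zero_iff.1 this
    exact ⟨w, hw, m, by rw [← hm]; abel⟩
  · rintro ⟨w, hw, m, h⟩
    refine ⟨w, hw, ?_⟩
    rw [h, map_add, torusExp_eq_zero_iff.2 ⟨m, rfl⟩, add_zero]

end SimplePolytope.CharFunction

/-! ### Radial parametrization of a face by a piece of the unit ball -/

namespace SimplePolytope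

variable {n : ℕ} {Q : SimplePolytope n}

open Classical in
/-- The gauge of the facets that do not contain `v`: the least `t ≥ 0` such that `w` satisfies the
inequalities of these facets, with origin `v` and scaled by the factor `t`. -/
def gaugeAt (Q : SimplePolytope n) (v w : EuclideanSpace ℝ (Fin n)) : ℝ≥0 :=
  Finset.univ.sup fun i =>
    if v ∈ Q.facet i then 0 else Real.toNNReal (-inner ℝ (Q.normal i) w / Q.slack i v)

lemma continuous_gaugeAt (v : EuclideanSpace ℝ (Fin n)) : Continuous (Q.gaugeAt v) := by
  unfold gaugeAt
  refine Continuous.finset_sup_apply fun i _ => ?_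
  split_ifs
  · exact continuous_const
  · fun_prop

section

variable {v : EuclideanSpace ℝ (Fin n)} (hvc : v ∈ Q.carrier)
include hvc

lemma gaugeAt_le_iff {w : EuclideanSpace ℝ (Fin n)} {t : ℝ} (ht : 0 ≤ t) :
    (Q.gaugeAt v w : ℝ) ≤ t ↔
      ∀ i, v ∉ Q.facet i → 0 ≤ t * Q.slack i v + inner ℝ (Q.normal i) w := by
  lift t to ℝ≥0 using ht
  rw [NNReal.coe_le_coe, gaugeAt, Finset.sup_le_iff]
  refine ⟨fun h i hi => ?_, fun h i _ => ?_⟩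
  · have h1 := h i (Finset.mem_univ i)
    rw [if_neg hi, Real.toNNReal_le_iff_le_coe, div_le_iff₀ (slack_pos hvc hi)] at h1
    linarith
  · split_ifs with hi
    · exact zero_le
    · rw [Real.toNNReal_le_iff_le_coe, div_le_iff₀ (slack_pos hvc hi)]
      linarith [h i hi]

lemma gaugeAt_lt_one_iff {w : EuclideanSpace ℝ (Fin n)} :
    (Q.gaugeAt v w : ℝ) < 1 ↔ ∀ i, v ∉ Q.facet i → 0 < Q.slack i (v + w) := by
  rw [← NNReal.coe_one, NNReal.coe_lt_coe, gaugeAt, Finset.sup_lt_iff (by simp)]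
  refine ⟨fun h i hi => ?_, fun h i _ => ?_⟩
  · have h1 := h i (Finset.mem_univ i)
    rw [if_neg hi, Real.toNNReal_lt_one, div_lt_one (slack_pos hvc hi)] at h1
    rw [slack_add]
    linarith
  · split_ifs with hi
    · exact zero_lt_one
    · rw [Real.toNNReal_lt_one, div_lt_one (slack_pos hvc hi)]
      have := h i hi
      rw [slack_add] at this
      linarith

lemma gaugeAt_smul_le {w : EuclideanSpace ℝ (Fin n)} {s : ℝ} (hs : 0 < s) :
    (Q.gaugeAt v (s • w) : ℝ) ≤ s * Q.gaugeAt v w := by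
  rw [gaugeAt_le_iff hvc (by positivity)]
  intro i hi
  have := (gaugeAt_le_iff hvc (w := w) (NNReal.coe_nonneg _)).1 le_rfl i hi
  rw [inner_smul_right, mul_assoc, ← mul_add]
  positivity

lemma gaugeAt_smul {w : EuclideanSpace ℝ (Fin n)} {s : ℝ} (hs : 0 < s) :
    (Q.gaugeAt v (s • w) : ℝ) = s * Q.gaugeAt v w := by
  refine le_antisymm (gaugeAt_smul_le hvc hs) ?_
  have h := gaugeAt_smul_le hvc (w := s • w) (inv_pos.2 hs)
  rw [smul_smul, inv_mul_cancel₀ hs.ne', one_smul, inv_mul_eq_div, le_div_iff₀ hs] at h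
  linarith

lemma gaugeAt_zero : Q.gaugeAt v 0 = 0 := by
  have : (Q.gaugeAt v 0 : ℝ) ≤ 0 := by
    rw [gaugeAt_le_iff hvc le_rfl]
    intro i _
    simp
  exact_mod_cast le_antisymm this (NNReal.coe_nonneg _)

end

section radial

variable {v : EuclideanSpace ℝ (Fin n)} (hv : v ∈ Q.vertices)
  {E : Set (EuclideanSpace ℝ (Fin n))}

lemma faceVec_injective : Function.Injective (faceVec hv E) := fun y z h => by
  ext j
  rw [← inner_normal_faceVec hv y j, h, inner_normal_faceVec]

lemma faceVec_mem_of_gaugeAt_le (hE : Q.IsFace E) (hvE : v ∈ E) {y : Q.FacetsAt E v → ℝ}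
    (hy : ∀ j, 0 ≤ y j) (h : (Q.gaugeAt v (faceVec hv E y) : ℝ) ≤ 1) :
    v + faceVec hv E y ∈ E := by
  refine add_faceVec_mem hv hE hvE hy fun i hi => ?_
  have := (gaugeAt_le_iff hv.1 zero_le_one).1 h i hi
  rwa [slack_add, ← one_mul (Q.slack i v)]

/-- The gauge is positive on the cone of a face, because the polytope is bounded. -/
lemma gaugeAt_faceVec_pos (hE : Q.IsFace E) (hvE : v ∈ E) {y : Q.FacetsAt E v → ℝ}
    (hy : ∀ j, 0 ≤ y j) (hy0 : y ≠ 0) : 0 < (Q.gaugeAt v (faceVec hv E y) : ℝ) := by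
  by_contra hneg
  have h0 : (Q.gaugeAt v (faceVec hv E y) : ℝ) = 0 :=
    le_antisymm (not_lt.1 hneg) (NNReal.coe_nonneg _)
  obtain ⟨M, hM⟩ := Q.bounded.exists_norm_le
  have hw : 0 < ‖faceVec hv E y‖ := by
    rw [norm_pos_iff]
    exact fun h => hy0 (faceVec_injective hv (by rw [h, map_zero]))
  have hM0 : 0 ≤ M := (norm_nonneg _).trans (hM v hv.1)
  set t := (2 * M + 1) / ‖faceVec hv E y‖
  have ht : 0 < t := by positivity
  have hmem : v + faceVec hv E (t • y) ∈ E := by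
    refine faceVec_mem_of_gaugeAt_le hv hE hvE (fun j => mul_nonneg ht.le (hy j)) ?_
    rw [map_smul, gaugeAt_smul hv.1 ht, h0]
    simp
  have h1 := hM _ (hE.subset_carrier hmem)
  have h2 := hM v hv.1
  have h3 : ‖faceVec hv E (t • y)‖ = 2 * M + 1 := by
    rw [map_smul, norm_smul, Real.norm_of_nonneg ht.le, div_mul_cancel₀ _ hw.ne']
  have h4 := norm_sub_le (v + faceVec hv E (t • y)) v
  rw [add_sub_cancel_left] at h4
  linarith

/-- The factor by which the radial parametrization stretches: it makes the gauge equal to the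
Euclidean norm. -/
def radialFactor (E : Set (EuclideanSpace ℝ (Fin n))) (r : EuclideanSpace ℝ (Q.FacetsAt E v)) : ℝ :=
  ‖r‖ / Q.gaugeAt v (faceVec hv E r.ofLp)

/-- The radial parametrization of `E` by the part of the unit ball in the closed orthant. -/
def radialPoint (E : Set (EuclideanSpace ℝ (Fin n))) (r : EuclideanSpace ℝ (Q.FacetsAt E v)) :
    EuclideanSpace ℝ (Fin n) :=
  v + faceVec hv E (radialFactor hv E r • r.ofLp)

lemma radialPoint_zero : radialPoint hv E 0 = v := by
  simp [radialPoint]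

lemma radialFactor_nonneg (r : EuclideanSpace ℝ (Q.FacetsAt E v)) : 0 ≤ radialFactor hv E r :=
  div_nonneg (norm_nonneg _) (NNReal.coe_nonneg _)

variable (hE : Q.IsFace E) (hvE : v ∈ E)
include hE hvE

lemma radialFactor_pos {r : EuclideanSpace ℝ (Q.FacetsAt E v)} (hr : ∀ j, 0 ≤ r j)
    (hr0 : r ≠ 0) : 0 < radialFactor hv E r :=
  div_pos (norm_pos_iff.2 hr0) (gaugeAt_faceVec_pos hv hE hvE hr
    fun h => hr0 (by ext j; exact congrFun h j))

lemma gaugeAt_radial {r : EuclideanSpace ℝ (Q.FacetsAt E v)} (hr : ∀ j, 0 ≤ r j) :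
    (Q.gaugeAt v (faceVec hv E (radialFactor hv E r • r.ofLp)) : ℝ) = ‖r‖ := by
  by_cases hr0 : r = 0
  · subst hr0; simp [gaugeAt_zero hv.1]
  · have hg := gaugeAt_faceVec_pos hv hE hvE hr fun h => hr0 (by ext j; exact congrFun h j)
    rw [map_smul, gaugeAt_smul hv.1 (radialFactor_pos hv hE hvE hr hr0), radialFactor,
      div_mul_cancel₀ _ hg.ne']

lemma radialPoint_mem {r : EuclideanSpace ℝ (Q.FacetsAt E v)} (hr : ∀ j, 0 ≤ r j)
    (hr1 : ‖r‖ ≤ 1) : radialPoint hv E r ∈ E :=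
  faceVec_mem_of_gaugeAt_le hv hE hvE
    (fun j => mul_nonneg (radialFactor_nonneg hv r) (hr j))
    ((gaugeAt_radial hv hE hvE hr).trans_le hr1)

lemma radialPoint_mem_facet_iff {r : EuclideanSpace ℝ (Q.FacetsAt E v)} (hr : ∀ j, 0 ≤ r j)
    (hr1 : ‖r‖ ≤ 1) (j : Q.FacetsAt E v) : radialPoint hv E r ∈ Q.facet j ↔ r j = 0 := by
  rw [mem_facet_iff, radialPoint, slack_faceVec]
  refine ⟨fun h => ?_, fun h => ⟨hE.subset_carrier (radialPoint_mem hv hE hvE hr hr1), ?_⟩⟩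
  · by_cases hr0 : r = 0
    · simp [hr0]
    · exact (mul_eq_zero.1 h.2).resolve_left (radialFactor_pos hv hE hvE hr hr0).ne'
  · exact mul_eq_zero_of_right _ h

lemma radialPoint_mem_openStar_iff {r : EuclideanSpace ℝ (Q.FacetsAt E v)} (hr : ∀ j, 0 ≤ r j)
    (hr1 : ‖r‖ ≤ 1) : radialPoint hv E r ∈ Q.openStar E v ↔ ‖r‖ < 1 := by
  have hmem := radialPoint_mem hv hE hvE hr hr1
  have hvc : v ∈ Q.carrier := hv.1
  rw [mem_openStar_iff hE, mem_faceAt_iff hvc, ← gaugeAt_radial hv hE hvE hr,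
    gaugeAt_lt_one_iff hvc]
  refine ⟨fun h i hi => slack_pos (hE.subset_carrier hmem) fun h' => hi (h.2 i h'),
    fun h => ⟨hmem, fun i hi => ?_⟩⟩
  by_contra h'
  exact (h i h').ne' (mem_facet_iff.1 hi).2

lemma radialPoint_injOn {r r' : EuclideanSpace ℝ (Q.FacetsAt E v)} (hr : ∀ j, 0 ≤ r j)
    (hr' : ∀ j, 0 ≤ r' j) (h : radialPoint hv E r = radialPoint hv E r') : r = r' := by
  have h1 : radialFactor hv E r • r.ofLp = radialFactor hv E r' • r'.ofLp :=
    faceVec_injective hv (add_left_cancel h)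
  have h2 : ‖r‖ = ‖r'‖ := by
    rw [← gaugeAt_radial hv hE hvE hr, h1, gaugeAt_radial hv hE hvE hr']
  by_cases hr0 : r = 0
  · rw [hr0, norm_zero] at h2
    rw [hr0, norm_eq_zero.1 h2.symm]
  have hr0' : r' ≠ 0 := by
    rintro rfl
    rw [norm_zero, norm_eq_zero] at h2
    exact hr0 h2
  have h3 : radialFactor hv E r • r = radialFactor hv E r' • r' := by
    ext j; exact congrFun h1 j
  have hp := radialFactor_pos hv hE hvE hr hr0
  have hp' := radialFactor_pos hv hE hvE hr' hr0'
  have h4 := congrArg norm h3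
  rw [norm_smul, norm_smul, Real.norm_of_nonneg hp.le, Real.norm_of_nonneg hp'.le, h2] at h4
  have h5 := mul_right_cancel₀ (norm_ne_zero_iff.2 hr0') h4
  rw [h5] at h3
  exact smul_right_injective _ hp'.ne' h3

lemma exists_radialPoint_eq {x : EuclideanSpace ℝ (Fin n)} (hx : x ∈ E) :
    ∃ r : EuclideanSpace ℝ (Q.FacetsAt E v), (∀ j, 0 ≤ r j) ∧ ‖r‖ ≤ 1 ∧
      radialPoint hv E r = x := by
  set y : EuclideanSpace ℝ (Q.FacetsAt E v) := WithLp.toLp 2 fun j => Q.slack j x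
  have hxy : x = v + faceVec hv E y.ofLp := eq_add_faceVec hv hvE hx
  have hy : ∀ j, 0 ≤ y j := fun j => hE.subset_carrier hx j
  have hg1 : (Q.gaugeAt v (faceVec hv E y.ofLp) : ℝ) ≤ 1 := by
    rw [gaugeAt_le_iff hv.1 zero_le_one]
    intro i _
    rw [one_mul, ← slack_add, ← hxy]
    exact hE.subset_carrier hx i
  by_cases hy0 : y = 0
  · refine ⟨0, fun j => le_rfl, by simp, ?_⟩
    rw [radialPoint_zero, hxy, hy0]
    simp
  have hg := gaugeAt_faceVec_pos hv hE hvE hy fun h => hy0 (by ext j; exact congrFun h j)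
  have hny : 0 < ‖y‖ := norm_pos_iff.2 hy0
  set s := (Q.gaugeAt v (faceVec hv E y.ofLp) : ℝ) / ‖y‖ with hs
  have hs0 : 0 < s := div_pos hg hny
  have hnorm : ‖s • y‖ = Q.gaugeAt v (faceVec hv E y.ofLp) := by
    rw [norm_smul, Real.norm_of_nonneg hs0.le, div_mul_cancel₀ _ hny.ne']
  refine ⟨s • y, fun j => mul_nonneg hs0.le (hy j), hnorm.trans_le hg1, ?_⟩
  have hf : radialFactor hv E (s • y) = s⁻¹ := by
    rw [radialFactor, hnorm, WithLp.ofLp_smul, map_smul, gaugeAt_smul hv.1 hs0]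
    field_simp
  rw [radialPoint, hf, WithLp.ofLp_smul, smul_smul, inv_mul_cancel₀ hs0.ne', one_smul, ← hxy]

lemma continuousOn_radialPoint :
    ContinuousOn (radialPoint hv E) {r | ∀ j, 0 ≤ r j} := by
  have hfv : Continuous (faceVec hv E) := LinearMap.continuous_of_finiteDimensional _
  intro r₀ hr₀
  by_cases h0 : r₀ = 0
  · subst h0
    -- the gauge is bounded below by a multiple of the norm, because `Q` is bounded
    obtain ⟨M, hM⟩ := Q.bounded.exists_norm_le
    have hbound : ∀ r : EuclideanSpace ℝ (Q.FacetsAt E v), (∀ j, 0 ≤ r j) →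
        ‖radialPoint hv E r - v‖ ≤ 2 * M * ‖r‖ := by
      intro r hr
      by_cases hr0 : r = 0
      · simp [hr0, radialPoint_zero]
      have hg := gaugeAt_faceVec_pos hv hE hvE hr fun h => hr0 (by ext j; exact congrFun h j)
      set ρ := (Q.gaugeAt v (faceVec hv E r.ofLp) : ℝ)
      have hmem : v + faceVec hv E (ρ⁻¹ • r.ofLp) ∈ E := by
        refine faceVec_mem_of_gaugeAt_le hv hE hvE
          (fun j => mul_nonneg (inv_pos.2 hg).le (hr j)) ?_
        rw [map_smul, gaugeAt_smul hv.1 (inv_pos.2 hg), inv_mul_cancel₀ hg.ne']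
      have h1 := hM _ (hE.subset_carrier hmem)
      have h2 := hM v hv.1
      have h4 := norm_sub_le (v + faceVec hv E (ρ⁻¹ • r.ofLp)) v
      rw [add_sub_cancel_left] at h4
      have e : radialPoint hv E r - v = ‖r‖ • faceVec hv E (ρ⁻¹ • r.ofLp) := by
        rw [radialPoint, add_sub_cancel_left, radialFactor, ← map_smul, smul_smul, div_eq_mul_inv]
      rw [e, norm_smul, norm_norm, mul_comm]
      exact mul_le_mul_of_nonneg_right (by linarith) (norm_nonneg _)
    rw [ContinuousWithinAt, radialPoint_zero, tendsto_iff_norm_sub_tendsto_zero]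
    have hlim : Filter.Tendsto (fun r : EuclideanSpace ℝ (Q.FacetsAt E v) => 2 * M * ‖r‖)
        (𝓝[{r | ∀ j, 0 ≤ r j}] 0) (𝓝 0) := by
      have : Continuous fun r : EuclideanSpace ℝ (Q.FacetsAt E v) => 2 * M * ‖r‖ := by fun_prop
      simpa using (this.tendsto 0).mono_left nhdsWithin_le_nhds
    refine squeeze_zero' (Filter.Eventually.of_forall fun _ => norm_nonneg _) ?_ hlim
    filter_upwards [self_mem_nhdsWithin] with r hr using hbound r hr
  · have hg := gaugeAt_faceVec_pos hv hE hvE hr₀ fun h => h0 (by ext j; exact congrFun h j)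
    refine ContinuousAt.continuousWithinAt ?_
    have hof : Continuous fun r : EuclideanSpace ℝ (Q.FacetsAt E v) => r.ofLp :=
      PiLp.continuous_ofLp 2 _
    have hfac : ContinuousAt (radialFactor hv E) r₀ := by
      refine ContinuousAt.div continuous_norm.continuousAt ?_ hg.ne'
      exact (NNReal.continuous_coe.comp
        ((continuous_gaugeAt v).comp (hfv.comp hof))).continuousAt
    exact continuousAt_const.add (hfv.continuousAt.comp (hfac.smul hof.continuousAt))

end radial

end SimplePolytope

/-! ### Characteristic maps of the cells -/

/-- The coordinatewise action of a torus on `ℂ^ι` by rotations. -/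
def diagonalRotation (ι : Type*) [Fintype ι] :
    (ι → Circle) →* (PiLp 2 (fun _ : ι => ℂ) ≃ₗᵢ[ℝ] PiLp 2 (fun _ : ι => ℂ)) where
  toFun c := LinearIsometryEquiv.piLpCongrRight 2 fun j => rotation (c j)
  map_one' := by ext z j; simp
  map_mul' c c' := by ext z j; simp

lemma diagonalRotation_apply {ι : Type*} [Fintype ι] (c : ι → Circle)
    (z : PiLp 2 (fun _ : ι => ℂ)) (j : ι) : diagonalRotation ι c z j = c j * z j := by
  simp [diagonalRotation]

/-- The vector of absolute values of the coordinates. -/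
def modulus {ι : Type*} (z : PiLp 2 (fun _ : ι => ℂ)) : EuclideanSpace ℝ ι :=
  WithLp.toLp 2 fun j => ‖z j‖

lemma modulus_apply {ι : Type*} (z : PiLp 2 (fun _ : ι => ℂ)) (j : ι) : modulus z j = ‖z j‖ := rfl

lemma norm_modulus {ι : Type*} [Fintype ι] (z : PiLp 2 (fun _ : ι => ℂ)) :
    ‖modulus z‖ = ‖z‖ := by
  simp [EuclideanSpace.norm_eq, modulus_apply]

/-- `θ` is a family of angles of the coordinates of `z`, in units of the full turn. There is no
condition on the angles of vanishing coordinates. -/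
def IsAngle {ι : Type*} (z : PiLp 2 (fun _ : ι => ℂ)) (θ : ι → ℝ) : Prop :=
  ∀ j, z j = ‖z j‖ * (Circle.exp (2 * Real.pi * θ j) : ℂ)

lemma isAngle_arg {ι : Type*} (z : PiLp 2 (fun _ : ι => ℂ)) :
    IsAngle z fun j => Complex.arg (z j) / (2 * Real.pi) := by
  intro j
  rw [mul_div_cancel₀ _ (by positivity), Circle.coe_exp, Complex.norm_mul_exp_arg_mul_I]

lemma IsAngle.exists_int {ι : Type*} {z : PiLp 2 (fun _ : ι => ℂ)} {θ θ' : ι → ℝ}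
    (h : IsAngle z θ) (h' : IsAngle z θ') : ∃ m : ι → ℤ, ∀ j, z j ≠ 0 → θ' j - θ j = m j := by
  have : ∀ j, ∃ m : ℤ, z j ≠ 0 → θ' j - θ j = m := by
    intro j
    by_cases hz : z j = 0
    · exact ⟨0, fun h => absurd hz h⟩
    have h1 := (h' j).symm.trans (h j)
    have h2 := mul_left_cancel₀ (by simpa using hz) h1
    obtain ⟨m, hm⟩ := Circle.exp_eq_exp.1 (Circle.ext h2)
    refine ⟨m, fun _ => ?_⟩
    have hpi : (2 * Real.pi) ≠ 0 := by positivity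
    refine mul_left_cancel₀ hpi ?_
    linear_combination hm
  choose m hm using this
  exact ⟨m, hm⟩

namespace SimplePolytope.CharFunction

variable {n : ℕ} {Q : SimplePolytope n}

/-- Angular coordinates on the torus modulo the subtorus of a face `E` with vertex `v`: integral
directions, one for each facet of `E` at `v`, and dual real coordinates, which detect the spans of
the characteristic vectors. -/
structure AngularCoordinates (lam : Q.CharFunction) (E : Set (EuclideanSpace ℝ (Fin n)))
    (v : EuclideanSpace ℝ (Fin n)) where
  dir : Q.FacetsAt E v → Fin n → ℤ
  coord : Q.FacetsAt E v → (Fin n → ℝ) →ₗ[ℝ] ℝ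
  coord_dir : ∀ j k, coord j (latticeToReal n (dir k)) = if j = k then 1 else 0
  mem_realSpan_iff : ∀ (S : Set (Q.FacetsAt E v)) (y : Fin n → ℝ),
    y ∈ lam.realSpan ({i | E ⊆ Q.facet i} ∪ Subtype.val '' S) ↔ ∀ j, j ∉ S → coord j y = 0

/-- Angular coordinates exist for any choice of vectors in the directions of the characteristic
vectors induced on `E`. -/
lemma exists_angularCoordinates (lam : Q.CharFunction) {E : Set (EuclideanSpace ℝ (Fin n))}
    {v : EuclideanSpace ℝ (Fin n)} (hv : v ∈ Q.vertices) (hvE : v ∈ E)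
    {u : Q.FacetsAt E v → lam.FaceLattice E}
    (hu : ∀ j, ∃ c : ℤ, c ≠ 0 ∧ c • u j = lam.rho E (lam.toFun j)) :
    ∃ A : lam.AngularCoordinates E v, ∀ j, lam.rho E (A.dir j) = u j := by
  choose c hc hcu using hu
  choose d hd using fun j => (lam.faceSublattice E).mkQ_surjective (u j)
  have hd' : ∀ j, lam.rho E (d j) = u j := hd
  refine ⟨⟨d, fun j => (c j : ℝ) • (lam.vertexBasis hv).coord ⟨j, j.2.1⟩, ?_, ?_⟩, hd'⟩
  · intro j k
    change (c j : ℝ) * (lam.vertexBasis hv).repr (latticeToReal n (d k)) ⟨j, j.2.1⟩ = _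
    rw [← lam.faceCoord_rho hv hvE, hd']
    have h := lam.faceCoord_rho_toFun hv hvE j k
    rw [← hcu k, map_smul, zsmul_eq_mul] at h
    by_cases hjk : j = k
    · subst hjk; exact h
    · rw [if_neg hjk, mul_eq_zero] at h
      rw [if_neg hjk, h.resolve_left (by exact_mod_cast hc k), mul_zero]
  · intro S y
    rw [lam.mem_realSpan_iff hv]
    · constructor
      · intro h j hj
        change (c j : ℝ) * (lam.vertexBasis hv).repr y ⟨j, j.2.1⟩ = 0
        rw [h ⟨j, j.2.1⟩, mul_zero]
        rintro (h' | ⟨k, hk, hkj⟩)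
        · exact j.2.2 h'
        · exact hj (Subtype.ext hkj ▸ hk)
      · intro h i hi
        have hi1 : ¬ E ⊆ Q.facet i := fun h' => hi (Or.inl h')
        have := h ⟨i, i.2, hi1⟩ fun h' => hi (Or.inr ⟨_, h', rfl⟩)
        change (c _ : ℝ) * (lam.vertexBasis hv).repr y i = 0 at this
        exact (mul_eq_zero.1 this).resolve_left (by exact_mod_cast hc _)
    · rintro i (hi | ⟨j, -, rfl⟩)
      · exact hi hvE
      · exact j.2.1

namespace AngularCoordinates

variable {lam : Q.CharFunction} {E : Set (EuclideanSpace ℝ (Fin n))}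
  {v : EuclideanSpace ℝ (Fin n)} (A : lam.AngularCoordinates E v)

/-- The finite group of the cell: the lattice of the face modulo the chosen directions. -/
abbrev CellGroup : Type :=
  lam.FaceLattice E ⧸ Submodule.span ℤ (Set.range fun j => lam.rho E (A.dir j))

/-- The combination of the directions with the given coefficients. -/
def combo : (Q.FacetsAt E v → ℝ) →ₗ[ℝ] (Fin n → ℝ) :=
  Fintype.linearCombination ℝ fun j => latticeToReal n (A.dir j)

lemma coord_combo (θ : Q.FacetsAt E v → ℝ) (j : Q.FacetsAt E v) :
    A.coord j (A.combo θ) = θ j := by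
  rw [combo, Fintype.linearCombination_apply, map_sum, Finset.sum_eq_single j]
  · rw [map_smul, A.coord_dir, if_pos rfl, smul_eq_mul, mul_one]
  · intro k _ hk
    rw [map_smul, A.coord_dir, if_neg hk.symm, smul_zero]
  · simp

lemma combo_intCast (m : Q.FacetsAt E v → ℤ) :
    A.combo (fun j => (m j : ℝ)) = latticeToReal n (∑ j, m j • A.dir j) := by
  rw [combo, Fintype.linearCombination_apply, map_sum]
  refine Finset.sum_congr rfl fun j _ => ?_
  rw [map_zsmul, Int.cast_smul_eq_zsmul]

lemma mem_realSpan_face_iff (y : Fin n → ℝ) :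
    y ∈ lam.realSpan {i | E ⊆ Q.facet i} ↔ ∀ j, A.coord j y = 0 := by
  have := A.mem_realSpan_iff ∅ y
  simpa using this

/-- The `j`-th angular coordinate of the cell group, with values in the circle. -/
def groupCoord (j : Q.FacetsAt E v) : A.CellGroup →+ UnitAddCircle :=
  ((Submodule.span ℤ (Set.range fun j => lam.rho E (A.dir j))).liftQ
    ((lam.faceSublattice E).liftQ
      ((((QuotientAddGroup.mk' (AddSubgroup.zmultiples (1 : ℝ))).toIntLinearMap).comp
        ((A.coord j).restrictScalars ℤ)).comp (latticeToReal n)) (by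
          intro m hm
          have h : A.coord j (latticeToReal n m) = 0 := (A.mem_realSpan_face_iff _).1 hm j
          simp [h]))
    (by
      rw [Submodule.span_le]
      rintro _ ⟨k, rfl⟩
      change ((A.coord j (latticeToReal n (A.dir k)) : ℝ) : UnitAddCircle) = 0
      rw [A.coord_dir]
      split_ifs
      · exact (AddCircle.coe_eq_zero_iff 1).2 ⟨1, by simp⟩
      · rfl)).toAddMonoidHom

/-- The class of an integral vector in the cell group. -/
def toGroup (m : Fin n → ℤ) : A.CellGroup := Submodule.Quotient.mk (lam.rho E m)

lemma toGroup_surjective : Function.Surjective A.toGroup := by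
  intro g
  obtain ⟨x, rfl⟩ := Submodule.Quotient.mk_surjective _ g
  obtain ⟨m, rfl⟩ := (lam.faceSublattice E).mkQ_surjective x
  exact ⟨m, rfl⟩

lemma groupCoord_toGroup (j : Q.FacetsAt E v) (m : Fin n → ℤ) :
    A.groupCoord j (A.toGroup m) = ((A.coord j (latticeToReal n m) : ℝ) : UnitAddCircle) := rfl

/-- The action of the cell group on `ℂ^d` by rotations of the coordinates. -/
def action : Multiplicative A.CellGroup →* (PiLp 2 (fun _ : Q.FacetsAt E v => ℂ) ≃ₗᵢ[ℝ]
    PiLp 2 (fun _ : Q.FacetsAt E v => ℂ)) :=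
  (diagonalRotation _).comp
    { toFun := fun g j => (A.groupCoord j g.toAdd).toCircle
      map_one' := by ext j; simp
      map_mul' := fun g g' => by ext j; simp [AddCircle.toCircle_add] }

lemma action_toGroup_apply (m : Fin n → ℤ) (z : PiLp 2 (fun _ : Q.FacetsAt E v => ℂ))
    (j : Q.FacetsAt E v) : A.action (.ofAdd (A.toGroup m)) z j =
      (Circle.exp (2 * Real.pi * A.coord j (latticeToReal n m)) : ℂ) * z j := by
  change diagonalRotation _ (fun j => (A.groupCoord j (A.toGroup m)).toCircle) z j = _
  rw [diagonalRotation_apply, groupCoord_toGroup, AddCircle.toCircle_apply_mk, div_one]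

variable (hv : v ∈ Q.vertices) (hE : Q.IsFace E) (hvE : v ∈ E)

/-- The characteristic map of the cell: the absolute values of the coordinates give a point of
the face by the radial parametrization, and their angles give an element of the torus. -/
def cellMap (z : Metric.closedBall (0 : PiLp 2 (fun _ : Q.FacetsAt E v => ℂ)) 1) :
    lam.ToricOrbifold :=
  Quotient.mk _ (⟨radialPoint hv E (modulus z.1), hE.subset_carrier
    (radialPoint_mem hv hE hvE (fun _ => norm_nonneg _)
      ((norm_modulus z.1).trans_le (mem_closedBall_zero_iff.1 z.2)))⟩,
    torusExp n (A.combo fun j => Complex.arg (z.1 j) / (2 * Real.pi)))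

lemma orbitMap_cellMap (z : Metric.closedBall (0 : PiLp 2 (fun _ : Q.FacetsAt E v => ℂ)) 1) :
    lam.orbitMap (A.cellMap hv hE hvE z) = radialPoint hv E (modulus z.1) := rfl

include hE hvE in
lemma realSpan_le_radialPoint (z : Metric.closedBall (0 : PiLp 2 (fun _ : Q.FacetsAt E v => ℂ)) 1) :
    lam.realSpan ({i | E ⊆ Q.facet i} ∪ Subtype.val '' {j | z.1 j = 0}) ≤
      lam.realSpan {i | radialPoint hv E (modulus z.1) ∈ Q.facet i} := by
  have h1 : ‖modulus z.1‖ ≤ 1 := (norm_modulus z.1).trans_le (mem_closedBall_zero_iff.1 z.2)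
  refine lam.realSpan_mono ?_
  rintro i (hi | ⟨j, hj, rfl⟩)
  · exact hi (radialPoint_mem hv hE hvE (fun _ => norm_nonneg _) h1)
  · refine (radialPoint_mem_facet_iff hv hE hvE (fun _ => norm_nonneg _) h1 j).2 ?_
    rw [modulus_apply, hj, norm_zero]

/-- Any choice of angles gives the same value of the characteristic map: the angles of nonzero
coordinates are determined up to integers, and those of vanishing coordinates are
irrelevant because the corresponding directions lie in the isotropy subtorus. -/
lemma cellMap_eq (z : Metric.closedBall (0 : PiLp 2 (fun _ : Q.FacetsAt E v => ℂ)) 1)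
    {θ : Q.FacetsAt E v → ℝ} (hθ : IsAngle z.1 θ) {x : Q.carrier}
    (hx : (x : EuclideanSpace ℝ (Fin n)) = radialPoint hv E (modulus z.1)) :
    A.cellMap hv hE hvE z = Quotient.mk _ (x, torusExp n (A.combo θ)) := by
  refine lam.mk_eq_mk_iff.2 ⟨Subtype.ext hx.symm, ?_⟩
  obtain ⟨m, hm⟩ := (isAngle_arg z.1).exists_int hθ
  refine ⟨A.combo (fun j => θ j - Complex.arg (z.1 j) / (2 * Real.pi) - m j), ?_,
    ∑ j, m j • A.dir j, ?_⟩
  · refine realSpan_le_radialPoint hv hE hvE z ((A.mem_realSpan_iff _ _).2 fun j hj => ?_)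
    rw [coord_combo, hm j hj, sub_self]
  · rw [← combo_intCast, ← map_add, ← map_sub]
    congr 1
    ext j
    simp

/-- The continuity of the characteristic map can be tested in polar coordinates, because these
are a quotient map from a compact space. -/
lemma continuous_cellMap : Continuous (A.cellMap hv hE hvE) := by
  let K : Set ((Q.FacetsAt E v → ℝ) × (Q.FacetsAt E v → ℝ)) :=
    (Set.univ.pi (fun _ => Set.Icc 0 1) ×ˢ Set.univ.pi (fun _ => Set.Icc (-1) 1)) ∩
      {p | ‖(WithLp.toLp 2 p.1 : EuclideanSpace ℝ (Q.FacetsAt E v))‖ ≤ 1}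
  have hK : IsCompact K := by
    refine ((isCompact_univ_pi fun _ => isCompact_Icc).prod
      (isCompact_univ_pi fun _ => isCompact_Icc)).inter_right ?_
    refine isClosed_le (continuous_norm.comp ?_) continuous_const
    exact (PiLp.continuous_toLp 2 _).comp continuous_fst
  have : CompactSpace K := isCompact_iff_compactSpace.1 hK
  let pol : (Q.FacetsAt E v → ℝ) × (Q.FacetsAt E v → ℝ) → PiLp 2 (fun _ : Q.FacetsAt E v => ℂ) :=
    fun p => WithLp.toLp 2 fun j => (p.1 j : ℂ) * (Circle.exp (2 * Real.pi * p.2 j) : ℂ)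
  have hpol : Continuous pol := by
    refine (PiLp.continuous_toLp 2 _).comp (continuous_pi fun j => ?_)
    fun_prop
  have hmod : ∀ p ∈ K, modulus (pol p) = WithLp.toLp 2 p.1 := by
    intro p hp
    ext j
    have : 0 ≤ p.1 j := (hp.1.1 j trivial).1
    rw [modulus_apply]
    change ‖(p.1 j : ℂ) * (Circle.exp (2 * Real.pi * p.2 j) : ℂ)‖ = p.1 j
    rw [norm_mul, Circle.norm_coe, mul_one, Complex.norm_of_nonneg this]
  have hnorm : ∀ p ∈ K, ‖pol p‖ ≤ 1 := by
    intro p hp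
    rw [← norm_modulus, hmod p hp]
    exact hp.2
  let q : K → Metric.closedBall (0 : PiLp 2 (fun _ : Q.FacetsAt E v => ℂ)) 1 := fun p =>
    ⟨pol p, mem_closedBall_zero_iff.2 (hnorm p p.2)⟩
  have hq : Continuous q := (hpol.comp continuous_subtype_val).subtype_mk _
  have hqs : Function.Surjective q := by
    intro z
    have hz : ‖z.1‖ ≤ 1 := mem_closedBall_zero_iff.1 z.2
    refine ⟨⟨(fun j => ‖z.1 j‖, fun j => Complex.arg (z.1 j) / (2 * Real.pi)),
      ⟨⟨fun j _ => ⟨norm_nonneg _, (PiLp.norm_apply_le z.1 j).trans hz⟩, fun j _ => ?_⟩, ?_⟩⟩, ?_⟩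
    · have h1 := Complex.neg_pi_lt_arg (z.1 j)
      have h2 := Complex.arg_le_pi (z.1 j)
      have h3 := Real.pi_pos
      constructor
      · rw [le_div_iff₀ (by positivity)]; linarith
      · rw [div_le_iff₀ (by positivity)]; linarith
    · exact (norm_modulus z.1).trans_le hz
    · refine Subtype.ext ?_
      ext j
      exact (isAngle_arg z.1 j).symm
  rw [(Topology.IsQuotientMap.of_surjective_continuous hqs hq).continuous_iff]
  have hrad : Continuous fun p : K => radialPoint hv E (WithLp.toLp 2 p.1.1) := by
    refine (continuousOn_radialPoint hv hE hvE).comp_continuous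
      ((PiLp.continuous_toLp 2 _).comp (continuous_fst.comp continuous_subtype_val)) fun p j => ?_
    exact (p.2.1.1 j trivial).1
  have hcar : ∀ p : K, radialPoint hv E (WithLp.toLp 2 p.1.1) ∈ Q.carrier := fun p =>
    hE.subset_carrier (radialPoint_mem hv hE hvE (fun j => (p.2.1.1 j trivial).1) p.2.2)
  have hcombo : Continuous A.combo := LinearMap.continuous_of_finiteDimensional _
  have : A.cellMap hv hE hvE ∘ q = fun p : K => Quotient.mk _
      ((⟨radialPoint hv E (WithLp.toLp 2 p.1.1), hcar p⟩ : Q.carrier),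
        torusExp n (A.combo p.1.2)) := by
    ext1 p
    refine A.cellMap_eq hv hE hvE (q p) (fun j => ?_) ?_
    · have h := congrArg (fun r => r.ofLp j) (hmod p p.2)
      simp only [modulus_apply] at h
      rw [show (q p).1 = pol p from rfl, h]
    · change _ = radialPoint hv E (modulus (pol p))
      rw [hmod p p.2]
  rw [this]
  exact continuous_quotient_mk'.comp ((hrad.subtype_mk _).prodMk
    ((continuous_torusExp n).comp (hcombo.comp (continuous_snd.comp continuous_subtype_val))))

/-- The characteristic map is invariant under the cell group. -/
lemma cellMap_action (g : Multiplicative A.CellGroup)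
    (z z' : Metric.closedBall (0 : PiLp 2 (fun _ : Q.FacetsAt E v => ℂ)) 1)
    (h : A.action g z.1 = z'.1) : A.cellMap hv hE hvE z = A.cellMap hv hE hvE z' := by
  obtain ⟨m, hm⟩ := A.toGroup_surjective g.toAdd
  obtain rfl : g = .ofAdd (A.toGroup m) := by rw [hm]; rfl
  have hz' : ∀ j, z'.1 j = (Circle.exp (2 * Real.pi * A.coord j (latticeToReal n m)) : ℂ) *
      z.1 j := fun j => by rw [← h, action_toGroup_apply]
  have hn : ∀ j, ‖z'.1 j‖ = ‖z.1 j‖ := fun j => by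
    rw [hz' j, norm_mul, Circle.norm_coe, one_mul]
  have hmod : modulus z'.1 = modulus z.1 := by ext j; exact hn j
  have hθ : IsAngle z'.1 fun j =>
      Complex.arg (z.1 j) / (2 * Real.pi) + A.coord j (latticeToReal n m) := by
    intro j
    have h1 := isAngle_arg z.1 j
    simp only at h1
    rw [hn j, mul_add, Circle.exp_add, Circle.coe_mul, ← mul_assoc, ← h1, hz' j, mul_comm]
  have hx : radialPoint hv E (modulus z.1) ∈ Q.carrier := hE.subset_carrier
    (radialPoint_mem hv hE hvE (fun _ => norm_nonneg _)
      ((norm_modulus z.1).trans_le (mem_closedBall_zero_iff.1 z.2)))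
  rw [A.cellMap_eq hv hE hvE z' hθ (x := ⟨_, hx⟩) (by rw [hmod])]
  refine lam.mk_eq_mk_iff.2 ⟨rfl, A.combo (fun j => A.coord j (latticeToReal n m)) -
    latticeToReal n m, ?_, m, ?_⟩
  · refine realSpan_le_radialPoint hv hE hvE z
      (lam.realSpan_mono Set.subset_union_left ((A.mem_realSpan_face_iff _).2 fun j => ?_))
    rw [map_sub, coord_combo, sub_self]
  · rw [← map_sub, sub_add_cancel]
    congr 1
    ext j
    simp

/-- On the open disc the fibres of the characteristic map are the orbits of the cell group. -/
lemma exists_action_eq_of_cellMap_eq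
    (z z' : Metric.closedBall (0 : PiLp 2 (fun _ : Q.FacetsAt E v => ℂ)) 1) (hz : ‖z.1‖ < 1)
    (h : A.cellMap hv hE hvE z = A.cellMap hv hE hvE z') : ∃ g, A.action g z.1 = z'.1 := by
  obtain ⟨hx, w, hw, m, hm⟩ := lam.mk_eq_mk_iff.1 h
  have hmod : modulus z.1 = modulus z'.1 := radialPoint_injOn hv hE hvE
    (fun _ => norm_nonneg _) (fun _ => norm_nonneg _) (congrArg Subtype.val hx)
  have hn : ∀ j, ‖z.1 j‖ = ‖z'.1 j‖ := fun j => congrArg (fun r => r.ofLp j) hmod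
  have hz1 : ‖modulus z.1‖ < 1 := (norm_modulus z.1).trans_lt hz
  -- at a point of the open star, the facets are those containing `E` and the coordinate facets
  have hfacets : {i | radialPoint hv E (modulus z.1) ∈ Q.facet i} ⊆
      {i | E ⊆ Q.facet i} ∪ Subtype.val '' {j : Q.FacetsAt E v | z.1 j = 0} := by
    intro i hi
    have hvi : v ∈ Q.facet i :=
      ((mem_openStar_iff hE).1 ((radialPoint_mem_openStar_iff hv hE hvE
        (fun _ => norm_nonneg _) hz1.le).2 hz1)).2.2 i hi
    by_cases hEi : E ⊆ Q.facet i
    · exact Or.inl hEi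
    · refine Or.inr ⟨⟨i, hvi, hEi⟩, ?_, rfl⟩
      exact norm_eq_zero.1 ((radialPoint_mem_facet_iff hv hE hvE
        (fun _ => norm_nonneg _) hz1.le ⟨i, hvi, hEi⟩).1 hi)
  have hw' := (A.mem_realSpan_iff _ _).1 (lam.realSpan_mono hfacets hw)
  refine ⟨.ofAdd (A.toGroup m), ?_⟩
  ext j
  rw [action_toGroup_apply]
  by_cases hj : z.1 j = 0
  · have : z'.1 j = 0 := by rw [← norm_eq_zero, ← hn j, hj, norm_zero]
    rw [hj, this, mul_zero]
  · have h1 := congrArg (A.coord j) hm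
    rw [map_sub, coord_combo, coord_combo, map_add, hw' j hj, zero_add] at h1
    have h2 := isAngle_arg z.1 j
    have h3 := isAngle_arg z'.1 j
    simp only at h2 h3
    generalize Complex.arg (z.1 j) / (2 * Real.pi) = α at h1 h2
    generalize Complex.arg (z'.1 j) / (2 * Real.pi) = β at h1 h3
    rw [h3, ← hn j, ← h1]
    conv_lhs => rw [h2]
    rw [mul_left_comm, ← Circle.coe_mul, ← Circle.exp_add]
    congr 3
    ring

lemma exists_cellMap_eq {x : lam.ToricOrbifold} (hx : lam.orbitMap x ∈ E) :
    ∃ z, A.cellMap hv hE hvE z = x := by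
  induction x using Quotient.inductionOn with | _ p => ?_
  obtain ⟨x, t⟩ := p
  obtain ⟨y, rfl⟩ := torusExp_surjective n t
  obtain ⟨r, hr, hr1, hrx⟩ := exists_radialPoint_eq hv hE hvE (x := x) hx
  let z : PiLp 2 (fun _ : Q.FacetsAt E v => ℂ) :=
    WithLp.toLp 2 fun j => (r j : ℂ) * (Circle.exp (2 * Real.pi * A.coord j y) : ℂ)
  have hn : ∀ j, ‖z j‖ = r j := fun j => by
    change ‖(r j : ℂ) * (Circle.exp (2 * Real.pi * A.coord j y) : ℂ)‖ = r j
    rw [norm_mul, Circle.norm_coe, mul_one, Complex.norm_of_nonneg (hr j)]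
  have hmod : modulus z = r := by ext j; exact hn j
  have hz : z ∈ Metric.closedBall (0 : PiLp 2 (fun _ : Q.FacetsAt E v => ℂ)) 1 := by
    rw [mem_closedBall_zero_iff, ← norm_modulus, hmod]
    exact hr1
  have hθ : IsAngle z fun j => A.coord j y := fun j => by rw [hn j]
  refine ⟨⟨z, hz⟩, ?_⟩
  rw [A.cellMap_eq hv hE hvE ⟨z, hz⟩ hθ (x := x) (by rw [← hrx]; exact congrArg _ hmod.symm)]
  refine lam.mk_eq_mk_iff.2 ⟨rfl, y - A.combo (fun j => A.coord j y), ?_, 0, by simp⟩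
  refine lam.realSpan_mono ?_ ((A.mem_realSpan_face_iff _).2 fun j => ?_)
  · exact fun i hi => hi hx
  · rw [map_sub, coord_combo, sub_self]

end AngularCoordinates

end SimplePolytope.CharFunction

namespace SimplePolytope.CharFunction

variable {n : ℕ} {Q : SimplePolytope n}

namespace AngularCoordinates

variable {lam : Q.CharFunction} {E : Set (EuclideanSpace ℝ (Fin n))}
  {v : EuclideanSpace ℝ (Fin n)}

/-- A linear isometry between `ℂ^ι` and the real space of twice the dimension. -/
def realIsometry {ι : Type*} [Fintype ι] {d : ℕ} (h : d = Fintype.card ι) :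
    EuclideanSpace ℝ (Fin (2 * d)) ≃ₗᵢ[ℝ] PiLp 2 (fun _ : ι => ℂ) :=
  ((stdOrthonormalBasis ℝ (PiLp 2 (fun _ : ι => ℂ))).reindex (finCongr (by
    rw [h, (WithLp.linearEquiv 2 ℝ (ι → ℂ)).finrank_eq, Module.finrank_pi_fintype]
    simp [mul_comm]))).repr.symm

/-- The cell group with its linear action on the real disc. -/
def discAction (A : lam.AngularCoordinates E v) [Finite A.CellGroup] {d : ℕ}
    (h : d = Fintype.card (Q.FacetsAt E v)) : DiscAction where
  dim := 2 * d
  G := Multiplicative A.CellGroup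
  finite := inferInstanceAs (Finite A.CellGroup)
  act :=
    { toFun := fun g => ((realIsometry h).trans (A.action g)).trans (realIsometry h).symm
      map_one' := by ext1 x; simp
      map_mul' := fun g g' => by ext1 x; simp }

end AngularCoordinates

/-- If a free vertex `v` with face `E` is removed from a complex, the preimage of the complex in
the toric orbifold arises by attaching one `q`-cell. -/
theorem exists_attach_cell (lam : Q.CharFunction) {E : Set (EuclideanSpace ℝ (Fin n))}
    {v : EuclideanSpace ℝ (Fin n)} (hv : v ∈ Q.vertices) (hE : Q.IsFace E) (hvE : v ∈ E)
    {u : Q.FacetsAt E v → lam.FaceLattice E}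
    (hu : ∀ j, ∃ c : ℤ, c ≠ 0 ∧ c • u j = lam.rho E (lam.toFun j))
    {B B' : Set (EuclideanSpace ℝ (Fin n))} (hB' : IsClosed B') (hsub : B' ⊆ B) (hEB : E ⊆ B)
    (hstar : Q.openStar E v = B \ B') {Y Y' : Set lam.ToricOrbifold}
    (hY : Y = lam.orbitMap ⁻¹' B') (hY' : Y' = lam.orbitMap ⁻¹' B) :
    ∃ D : DiscAction, D.dim = 2 * affDim E ∧
      Nat.card D.G = Nat.card (lam.FaceLattice E ⧸ Submodule.span ℤ (Set.range u)) ∧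
      ∃ φ : D.QSphere → Y, Continuous φ ∧ ∃ h : D.Attach φ ≃ₜ Y',
        (∀ y, (h (Quot.mk _ (Sum.inl y)) : lam.ToricOrbifold) = y) ∧
        lam.orbitMap ⁻¹' {v} = {(h (Quot.mk _ (Sum.inr D.origin)) : lam.ToricOrbifold)} ∧
        ∃ U ∈ 𝓝 (h (Quot.mk _ (Sum.inr D.origin))), Nonempty (U ≃ₜ D.QCell) := by
  classical
  obtain ⟨A, hA⟩ := lam.exists_angularCoordinates hv hvE hu
  have hAu : (fun j => lam.rho E (A.dir j)) = u := funext hA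
  have hcard : Nat.card A.CellGroup =
      Nat.card (lam.FaceLattice E ⧸ Submodule.span ℤ (Set.range u)) := by
    subst hAu; rfl
  have hfin : Finite A.CellGroup := by
    refine Nat.finite_of_card_ne_zero ?_
    have hli := lam.linearIndependent_of_smul_eq hv hvE hu
    obtain ⟨b⟩ := lam.nonempty_basis_faceLattice hv hvE
    rw [hcard, card_quotient_span_range b hli]
    exact natAbs_det_ne_zero b hli
  have hd := affDim_eq_card hv hE hvE
  let D : DiscAction := A.discAction hd
  let Φ : EuclideanSpace ℝ (Fin D.dim) ≃ₗᵢ[ℝ] PiLp 2 (fun _ : Q.FacetsAt E v => ℂ) :=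
    AngularCoordinates.realIsometry hd
  have hact : ∀ (g : Multiplicative A.CellGroup) x y,
      D.act g x = y ↔ A.action g (Φ x) = Φ y := fun g x y =>
    LinearIsometryEquiv.symm_apply_eq Φ
  let ψ : Metric.closedBall (0 : EuclideanSpace ℝ (Fin D.dim)) 1 →
      Metric.closedBall (0 : PiLp 2 (fun _ : Q.FacetsAt E v => ℂ)) 1 := fun x =>
    ⟨Φ x.1, by
      rw [mem_closedBall_zero_iff, LinearIsometryEquiv.norm_map]
      exact mem_closedBall_zero_iff.1 x.2⟩
  have hψn : ∀ x, ‖(ψ x).1‖ = ‖x.1‖ := fun x => Φ.norm_map x.1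
  have hψs : Function.Surjective ψ := fun z =>
    ⟨⟨Φ.symm z.1, by
      rw [mem_closedBall_zero_iff, LinearIsometryEquiv.norm_map]
      exact mem_closedBall_zero_iff.1 z.2⟩, Subtype.ext (Φ.apply_symm_apply z.1)⟩
  have hψ : Continuous ψ := (Φ.continuous.comp continuous_subtype_val).subtype_mk _
  let f : Metric.closedBall (0 : EuclideanSpace ℝ (Fin D.dim)) 1 → lam.ToricOrbifold := fun x =>
    A.cellMap hv hE hvE (ψ x)
  have hπ : ∀ x, lam.orbitMap (f x) = radialPoint hv E (modulus (ψ x).1) := fun x => rfl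
  have hm1 : ∀ x, ‖modulus (ψ x).1‖ ≤ 1 := fun x => by
    rw [norm_modulus]; exact mem_closedBall_zero_iff.1 (ψ x).2
  have hstar' : ∀ x, lam.orbitMap (f x) ∈ Q.openStar E v ↔ ‖x.1‖ < 1 := by
    intro x
    rw [hπ, radialPoint_mem_openStar_iff hv hE hvE (fun _ => norm_nonneg _) (hm1 x),
      norm_modulus, hψn]
  have hfE : ∀ x, lam.orbitMap (f x) ∈ E := fun x =>
    radialPoint_mem hv hE hvE (fun _ => norm_nonneg _) (hm1 x)
  obtain ⟨φ, hφ, h, h1, h2, h3⟩ := D.exists_homeo_attach (Y := Y) (Y' := Y')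
    (by rw [hY]; exact (hB'.preimage lam.continuous_orbitMap).isCompact) f
    ((A.continuous_cellMap hv hE hvE).comp hψ)
    (fun x y ⟨g, hg⟩ => A.cellMap_action hv hE hvE g _ _ ((hact g _ _).1 hg))
    (fun x y hx _ hxy => by
      obtain ⟨g, hg⟩ := A.exists_action_eq_of_cellMap_eq hv hE hvE (ψ x) (ψ y)
        ((hψn x).trans_lt hx) hxy
      exact ⟨g, (hact g _ _).2 hg⟩)
    (fun x => by
      rw [hY, Set.mem_preimage]
      have hle : ‖x.1‖ ≤ 1 := mem_closedBall_zero_iff.1 x.2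
      have := hstar' x
      rw [hstar, Set.mem_sdiff] at this
      constructor
      · intro hx
        exact le_antisymm hle (not_lt.1 fun hlt => (this.2 hlt).2 hx)
      · intro hx
        by_contra hx'
        exact (this.1 ⟨hEB (hfE x), hx'⟩).ne hx)
    (by
      rw [hY, hY']
      ext q
      constructor
      · intro hq
        by_cases hq' : lam.orbitMap q ∈ B'
        · exact Or.inl hq'
        · have hqs : lam.orbitMap q ∈ Q.openStar E v := hstar ▸ ⟨hq, hq'⟩
          obtain ⟨z, rfl⟩ := A.exists_cellMap_eq hv hE hvE hqs.1
          obtain ⟨x, rfl⟩ := hψs z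
          exact Or.inr ⟨x, rfl⟩
      · rintro (hq | ⟨x, rfl⟩)
        · exact hsub hq
        · exact hEB (hfE x))
  refine ⟨D, rfl, hcard, φ, hφ, h, h1, ?_, h3⟩
  rw [h2]
  have hzero : (modulus (0 : PiLp 2 (fun _ : Q.FacetsAt E v => ℂ))) = 0 := by
    rw [← norm_eq_zero, norm_modulus, norm_zero]
  ext q
  rw [Set.mem_preimage, Set.mem_singleton_iff, Set.mem_singleton_iff]
  constructor
  · intro hq
    obtain ⟨z, rfl⟩ := A.exists_cellMap_eq hv hE hvE (x := q) (hq ▸ hvE)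
    rw [A.orbitMap_cellMap] at hq
    have h0 := radialPoint_injOn hv hE hvE (r := modulus z.1) (r' := 0) (fun _ => norm_nonneg _)
      (fun _ => le_rfl) (hq.trans (radialPoint_zero hv).symm)
    have hz : z.1 = 0 := by rw [← norm_eq_zero, ← norm_modulus, h0, norm_zero]
    refine congrArg _ (Subtype.ext ?_)
    rw [hz]
    exact (map_zero Φ).symm
  · rintro rfl
    rw [hπ]
    have : (ψ ⟨0, by simp⟩).1 = 0 := map_zero Φ
    rw [this, hzero, radialPoint_zero]

/-! ### Orders of the cell groups -/

/-- The projection to the lattice of the whole polytope is an isomorphism, so it preserves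
primitivity. -/
lemma isPrimitiveVector_rho_carrier (lam : Q.CharFunction) {v : EuclideanSpace ℝ (Fin n)}
    (hv : v ∈ Q.vertices) {w : Fin n → ℤ} (hw : IsPrimitiveVector w) :
    IsPrimitiveVector (lam.rho Q.carrier w) := by
  classical
  have hempty : {i | Q.carrier ⊆ Q.facet i} = ∅ := by
    have hcard := affDim_eq_card hv (isFace_carrier ⟨v, hv.1⟩) hv.1
    have h2 : Fintype.card {i // v ∈ Q.facet i} = Fintype.card (Q.FacetsAt Q.carrier v) := by
      rw [card_facets_through hv, ← hcard, Q.affDim_carrier]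
    rw [Set.eq_empty_iff_forall_notMem]
    intro i hi
    rw [Fintype.card_subtype, Fintype.card_subtype] at h2
    have h3 := Finset.eq_of_subset_of_card_le
      (Finset.monotone_filter_right Finset.univ fun j _ hj => hj.1) h2.le
    have : i ∈ Finset.univ.filter fun j => v ∈ Q.facet j := by
      simp only [Finset.mem_filter, Finset.mem_univ, true_and]
      exact hi hv.1
    rw [← h3] at this
    exact (Finset.mem_filter.1 this).2.2 hi
  have hbot : lam.faceSublattice Q.carrier = ⊥ := by
    rw [Submodule.eq_bot_iff]
    intro m hm
    have h : latticeToReal n m ∈ lam.realSpan {i | Q.carrier ⊆ Q.facet i} := hm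
    rw [hempty, realSpan, Set.image_empty, Submodule.span_empty, Submodule.mem_bot] at h
    exact latticeToReal_injective n (h.trans (map_zero _).symm)
  exact hw.map_equiv ((lam.faceSublattice Q.carrier).quotEquivOfEqBot hbot).symm

open Classical in
/-- The directions used for the cell of a free vertex. They are the induced characteristic
vectors, except that on an interval all characteristic vectors are made primitive if some of
them are not. -/
def cellVector (lam : Q.CharFunction) (E : Set (EuclideanSpace ℝ (Fin n)))
    (j : Fin Q.numFacets) : lam.FaceLattice E :=
  if n = 1 → ∀ j, IsPrimitiveVector (lam.toFun j) then lam.inducedVector E j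
  else primitiveVector (lam.rho E (lam.toFun j))

lemma exists_smul_cellVector (lam : Q.CharFunction) (E : Set (EuclideanSpace ℝ (Fin n)))
    (j : Fin Q.numFacets) :
    ∃ c : ℤ, c ≠ 0 ∧ c • lam.cellVector E j = lam.rho E (lam.toFun j) := by
  unfold cellVector inducedVector
  split_ifs
  · exact ⟨1, one_ne_zero, one_smul _ _⟩
  all_goals exact exists_smul_primitiveVector _

variable (lam : Q.CharFunction) {E : Set (EuclideanSpace ℝ (Fin n))}
    {v : EuclideanSpace ℝ (Fin n)} (hv : v ∈ Q.vertices) (hE : Q.IsFace E) (hvE : v ∈ E)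
include hv hvE

lemma card_quotient_cellVector_eq_g (hprim : n = 1 → ∀ j, IsPrimitiveVector (lam.toFun j)) :
    Nat.card (lam.FaceLattice E ⧸ Submodule.span ℤ
      (Set.range fun j : Q.FacetsAt E v => lam.cellVector E j)) = lam.g E v := by
  rw [← lam.card_quotient_inducedVector hv hvE]
  simp only [cellVector, if_pos hprim]

include hE

/-- For a face of dimension at most one, the directions of the cell are primitive, so they
generate the lattice of the face. -/
lemma card_quotient_cellVector_eq_one (hdim : affDim E ≤ 1) :
    Nat.card (lam.FaceLattice E ⧸ Submodule.span ℤ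
      (Set.range fun j : Q.FacetsAt E v => lam.cellVector E j)) = 1 := by
  classical
  obtain ⟨b⟩ := lam.nonempty_basis_faceLattice hv hvE
  rw [card_quotient_span_range b (lam.linearIndependent_of_smul_eq hv hvE
    fun j => lam.exists_smul_cellVector E j)]
  have hcard := affDim_eq_card hv hE hvE
  refine natAbs_det_eq_one_of_card_le_one b (hcard ▸ hdim) fun j => ?_
  have hp := isPrimitiveVector_primitiveVector b (lam.rho_toFun_ne_zero hv hvE j)
  unfold cellVector inducedVector
  split_ifs with h1 h2
  · subst h2
    have hn : n = 1 := by
      have h0 : 0 < Fintype.card (Q.FacetsAt Q.carrier v) := Fintype.card_pos_iff.2 ⟨j⟩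
      rw [← hcard, Q.affDim_carrier] at h0
      rw [Q.affDim_carrier] at hdim
      omega
    exact lam.isPrimitiveVector_rho_carrier hv (h1 hn j)
  · exact hp
  · exact hp

end SimplePolytope.CharFunction

end

/-! ### The building sequence of the toric orbifold -/

theorem mainTheorem7 (n : ℕ) (Q : SimplePolytope n) (hQ : Q.Admissible)
    (lam : Q.CharFunction) (hgcd : lam.GcdCondition) (p : ℕ) (hp : p.Prime) :
    ∃ (R : Q.RetractionSequence) (S : BuildingSequence lam.ToricOrbifold Q.numVertices),
      S.IsInducedBy R ∧
      (∀ i, Even (S.cell i).dim) ∧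
      (∀ i, Nat.Coprime p (Nat.card (S.cell i).G)) ∧
      ((n = 1 → ∀ j, IsPrimitiveVector (lam.toFun j)) →
        (∀ i, Nat.Coprime p (lam.g (R.E i) (R.b i))) ∧
        ∀ i, Nat.card (S.cell i).G = lam.g (R.E i.rev) (R.b i.rev)) := by
  obtain ⟨R, hR⟩ := hQ.exists_retractionSequence fun v E => ¬ p ∣ lam.g E v
  have hv : ∀ k, R.b k ∈ Q.vertices := fun k => (R.free k).1
  have hE : ∀ k, Q.IsFace (R.E k) := fun k => (R.free k).2.1
  have hvE : ∀ k, R.b k ∈ R.E k := fun k => (R.free k).2.2.2.1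
  let N : Fin Q.numVertices → ℕ := fun k => Nat.card (lam.FaceLattice (R.E k) ⧸
    Submodule.span ℤ (Set.range fun j : Q.FacetsAt (R.E k) (R.b k) => lam.cellVector (R.E k) j))
  have hNg : (n = 1 → ∀ j, IsPrimitiveVector (lam.toFun j)) →
      ∀ k, N k = lam.g (R.E k) (R.b k) := fun hprim k =>
    lam.card_quotient_cellVector_eq_g (hv k) (hvE k) hprim
  have hNp : ∀ k, Nat.Coprime p (N k) := by
    intro k
    by_cases hdim : affDim (R.E k) ≤ 1
    · have : N k = 1 := lam.card_quotient_cellVector_eq_one (hv k) (hE k) (hvE k) hdim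
      rw [this]
      exact Nat.coprime_one_right p
    -- a face of dimension at least two does not occur for `n = 1`, so primitivity is not needed
    · have hprim : n = 1 → ∀ j, IsPrimitiveVector (lam.toFun j) := fun h => by
        have := SimplePolytope.affDim_le (R.E k)
        omega
      rw [hNg hprim k, hp.coprime_iff_not_dvd]
      refine hR k ?_
      -- otherwise `p` divides all the numbers whose gcd is assumed to be `1`
      by_contra hno
      push Not at hno
      exact hp.one_lt.ne' (hgcd R k ⟨R.E k, hE k, (R.free k).2.2.1, not_le.1 hdim⟩ p hno)
  have hpos : 0 < Q.numVertices := by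
    obtain ⟨v, hv, -⟩ := (SimplePolytope.isFace_carrier (Q := Q)
      (Q.full_dim.mono interior_subset)).exists_vertex_mem
    exact (Set.ncard_pos SimplePolytope.finite_vertices).2 ⟨v, hv⟩
  -- the complexes are filled up in the order opposite to the one of their removal
  let Y : Fin (Q.numVertices + 1) → Set lam.ToricOrbifold := fun i =>
    lam.orbitMap ⁻¹' R.stage (Q.numVertices - i)
  have hYc : ∀ i : Fin Q.numVertices,
      Y i.castSucc = lam.orbitMap ⁻¹' R.stage ((i.rev : ℕ) + 1) := by
    intro i
    simp only [Y, Fin.val_castSucc, Fin.val_rev]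
    congr 2
    omega
  have hYs : ∀ i : Fin Q.numVertices, Y i.succ = lam.orbitMap ⁻¹' R.stage (i.rev : ℕ) := by
    intro i
    simp only [Y, Fin.val_succ, Fin.val_rev]
  have hcell := fun i : Fin Q.numVertices =>
    lam.exists_attach_cell (hv i.rev) (hE i.rev) (hvE i.rev)
      (u := fun j => lam.cellVector (R.E i.rev) j)
      (fun j => lam.exists_smul_cellVector (R.E i.rev) j)
      (R.isComplex_stage _).isClosed (R.stage_succ_subset i.rev)
      (by rw [R.stage_of_lt]; exact (R.free i.rev).2.2.1)
      (R.openStar_eq i.rev) (hYc i) (hYs i)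
  choose D hDdim hDcard φ hφ h h1 h2 h3 using hcell
  refine ⟨R, ⟨Y, ?_, ?_, D, φ, hφ, h, h1, h3⟩, fun i => ⟨?_, h2 i, hDdim i⟩, fun i => ?_,
    fun i => ?_, fun hprim => ⟨fun i => ?_, fun i => ?_⟩⟩
  · simp only [Y, Fin.val_zero, Nat.sub_zero]
    rw [R.stage_of_le le_rfl, Set.preimage_empty]
  · simp only [Y, Fin.val_last, Nat.sub_self]
    have h0 : R.stage 0 = Q.carrier := (R.stage_of_lt ⟨0, hpos⟩).trans (R.B_zero hpos)
    rw [h0, Set.eq_univ_iff_forall]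
    intro q
    induction q using Quotient.inductionOn with | _ a => exact a.1.2
  · exact (hYs i).trans (congrArg _ (R.iUnion_openStar i.rev).symm)
  · exact ⟨affDim (R.E i.rev), (hDdim i).trans (two_mul _)⟩
  · exact (hDcard i).symm ▸ hNp i.rev
  · exact hNg hprim i ▸ hNp i
  · exact (hDcard i).trans (hNg hprim i.rev)
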